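/- An $\mathbb{R}$-tree is a geodesic metric space in which the union of two segments meeting in exactly one point, an endpoint of both, is a segment, and the intersection of two segments with a common endpoint is a segment. It has valence $\kappa$ if for every point $x$ the set of geodesic-connected components of the complement of $x$ has cardinality $\kappa$. The complete (non-empty) $\mathbb{R}$-tree with valence $2^{\aleph_0}$ is called universal. An action of a group $G$ on a metric space $X$ is cobounded if the translates of some bounded set cover $X$. A subset $C \subseteq X$ is convex if $z \in C$ whenever $x, y \in C$ and $d(x,z) + d(z,y) = d(x,y)$. The action is essential if no non-empty proper convex subset of $X$ is $G$-invariant. A group splits non-trivially as a direct product if it is isomorphic to $A \times B$ for some non-trivial groups $A$ and $B$. **Corollary C.** There exist a complete universal $\mathbb{R}$-tree $T$ with valence $2^{\aleph_0}$ and, writing $T_1 = T_2 = T$, a subgroup $G \leq \mathrm{Isom}(T_1) \times \mathrm{Isom}(T_2)$ such that the coordinatewise action of $G$ on the $\ell^1$-product $T_1 \times T_2$ (with metric $d((x_1,x_2),(y_1,y_2)) = d(x_1,y_1) + d(x_2,y_2)$) is by isometries, free and transitive, and: 1. $G$ is coboundedly irreducible: for every subgroup $H \leq G$ which splits non-trivially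 as a direct product, the induced action of $H$ on $T_1 \times T_2$ is not cobounded; 2. $G$ is essentially reducible: there is a subgroup $H \leq G$ which splits non-trivially as a direct product and whose induced action on $T_1 \times T_2$ is essential. -/

import Mathlib

universe u v

/-- `S` is the image of a geodesic from `x` to `y`, i.e. of an isometric embedding
`γ : [0, l] → X` with `γ 0 = x` and `γ l = y`. -/
def IsSegmentBetween {X : Type u} [MetricSpace X] (x y : X) (S : Set X) : Prop :=
  ∃ (l : ℝ) (γ : ℝ → X), 0 ≤ l ∧
    (∀ s ∈ Set.Icc (0 : ℝ) l, ∀ t ∈ Set.Icc (0 : ℝ) l, dist (γ s) (γ t) = |s - t|) ∧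
    γ 0 = x ∧ γ l = y ∧ S = γ '' Set.Icc (0 : ℝ) l

/-- `S` is a segment: the image of some geodesic. -/
def IsSegment {X : Type u} [MetricSpace X] (S : Set X) : Prop :=
  ∃ x y : X, IsSegmentBetween x y S

/-- `ℝ`-trees: geodesic metric spaces in which two segments meeting in exactly one point, an
endpoint of both, have a segment as their union, and in which the intersection of two segments
with a common endpoint is a segment. -/
structure IsRealTree (X : Type u) [MetricSpace X] : Prop where
  geodesic : ∀ x y : X, ∃ S : Set X, IsSegmentBetween x y S
  union : ∀ (x y z : X) (S S' : Set X), IsSegmentBetween x y S → IsSegmentBetween y z S' →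
    S ∩ S' = {y} → IsSegment (S ∪ S')
  inter : ∀ (x y z : X) (S S' : Set X), IsSegmentBetween x y S → IsSegmentBetween x z S' →
    IsSegment (S ∩ S')

/-- The set of geodesic-connected components of `X - {x}`: the quotient of `X - {x}` by the
equivalence relation generated by "`y` and `z` are joined by a segment that avoids `x`". -/
def Direction {X : Type u} [MetricSpace X] (x : X) : Type u :=
  Quot fun y z : {w : X // w ≠ x} => ∃ S : Set X, IsSegmentBetween (y : X) (z : X) S ∧ x ∉ S

/-- Every point of `X` has valence `κ`. -/
def HasValence (X : Type u) [MetricSpace X] (κ : Cardinal.{u}) : Prop :=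
  ∀ x : X, Cardinal.mk (Direction x) = κ

/-- `Isom X × Isom Y` acts coordinatewise on the `ℓ¹` product of `X` and `Y`. -/
noncomputable instance isomProdAction (X : Type u) (Y : Type v) [MetricSpace X] [MetricSpace Y] :
    MulAction ((X ≃ᵢ X) × (Y ≃ᵢ Y)) (WithLp 1 (X × Y)) where
  smul g p := WithLp.toLp 1 (g.1 p.fst, g.2 p.snd)
  one_smul _ := rfl
  mul_smul _ _ _ := rfl

/-- The group `G` is isomorphic to a direct product of two non-trivial groups. -/
def SplitsNontrivially (G : Type u) [Group G] : Prop :=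
  ∃ (A B : Type u) (_ : Group A) (_ : Group B),
    Nontrivial A ∧ Nontrivial B ∧ Nonempty (G ≃* A × B)

/-- An action is cobounded if the translates of some bounded set cover the space. -/
def IsCoboundedAction (G : Type u) (X : Type v) [Group G] [MetricSpace X] [MulAction G X] : Prop :=
  ∃ B : Set X, Bornology.IsBounded B ∧ ∀ x : X, ∃ g : G, ∃ b ∈ B, g • b = x

/-- Convexity in median spaces: `C` contains the interval
`{z | d(x,z) + d(z,y) = d(x,y)}` between any two of its points `x` and `y`. -/
def IsIntervalConvex {X : Type u} [MetricSpace X] (C : Set X) : Prop :=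
  ∀ x ∈ C, ∀ y ∈ C, ∀ z : X, dist x z + dist z y = dist x y → z ∈ C

/-- An action is essential if there is no proper non-empty invariant convex subspace. -/
def IsEssentialAction (G : Type u) (X : Type v) [Group G] [MetricSpace X] [MulAction G X] : Prop :=
  ∀ C : Set X, C.Nonempty → IsIntervalConvex C → (∀ g : G, ∀ x ∈ C, g • x ∈ C) → C = Set.univ

/-- Some subgroup that splits non-trivially as a direct product acts coboundedly. -/
def CoboundedlyReducible (G : Type u) (X : Type v) [Group G] [MetricSpace X] [MulAction G X] :
    Prop :=
  ∃ H : Subgroup G, SplitsNontrivially H ∧ IsCoboundedAction H X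

/-- Some subgroup that splits non-trivially as a direct product acts essentially. -/
def EssentiallyReducible (G : Type u) (X : Type v) [Group G] [MetricSpace X] [MulAction G X] :
    Prop :=
  ∃ H : Subgroup G, SplitsNontrivially H ∧ IsEssentialAction H X

/-! The tree consists of the non-backtracking `1`-Lipschitz paths in `V = ℂ × ℂ` issuing from `0`,
two paths being as far apart as the combined length of what remains after their common beginning.
Reduced concatenation makes every path a left translation, and the endpoint map to `V` is
`1`-Lipschitz and turns left translations into translations of `V`. An isometry of the tree that
covers a map of `V` and fixes the base point is determined by that map, since endpoints of initial
subpaths recover a path (`Covers.eq_map`). So the isometries covering translations act freely and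
transitively.

`twistedGroup` couples two such trees: if the first coordinate covers translation by `c`, the second
covers an affine isometry with linear part `twist c.1.re`. A fixed point in the first tree forces `c
= 0`, which untwists the second coordinate; freeness and transitivity persist.

Suppose `A × B` acts coboundedly. If on one tree both factors contain fixed point free elements,
commuting makes their axes equal, so the displacement is constant on a coarsely dense orbit and
hence bounded (`displacement_bounded`); this contradicts `unbounded_displacement`. Hence one factor,
say `A`, is trivial on the first tree, and thus free of fixed points on the second for non-trivial
elements. There every `b` in `B` has a fixed point, so fixes the axis of an element of `A`, and
therefore has bounded displacement. A twisted isometry with a fixed point moves long straight paths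
arbitrarily far, so `b` is untwisted and its height `c.1.re` vanishes. But then `B` cannot act
coboundedly on the first tree.

Essentially, the untwisted elements already suffice: `levelGroup × translationGroup` lies in the
twisted group, and every point of the first tree lies between two points of any given
`levelGroup`-orbit. -/

/-! ### Geodesic `0`-hyperbolic spaces -/

/-- `z` lies on a geodesic from `x` to `y`. -/
def IsBetween {X : Type u} [MetricSpace X] (x z y : X) : Prop :=
  dist x z + dist z y = dist x y

/-- Spaces satisfying Gromov's four point inequality with `δ = 0` in which all distances
between two points are interpolated. -/
structure IsTreeLike (X : Type u) [MetricSpace X] : Prop where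
  four_point : ∀ x y z w : X,
    dist x y + dist z w ≤ max (dist x z + dist y w) (dist x w + dist y z)
  exists_between : ∀ (x y : X) (s : ℝ), 0 ≤ s → s ≤ dist x y →
    ∃ z, dist x z = s ∧ dist z y = dist x y - s

/-- For an isometry without fixed points this is its axis. -/
def axisSet {X : Type u} [MetricSpace X] (p : X ≃ᵢ X) : Set X :=
  {z | dist z (p (p z)) = 2 * dist z (p z)}

theorem mem_axisSet_of_commute {X : Type u} [MetricSpace X] {p q : X ≃ᵢ X} (h : Commute p q) {z : X}
    (hz : z ∈ axisSet p) : q z ∈ axisSet p := by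
  have hc : ∀ w, p (q w) = q (p w) := fun w => DFunLike.congr_fun h.eq w
  change dist (q z) (p (p (q z))) = 2 * dist (q z) (p (q z))
  rw [hc, hc, q.dist_eq, q.dist_eq]
  exact hz

namespace IsBetween

variable {X : Type u} [MetricSpace X] {x y z : X}

theorem symm (h : IsBetween x z y) : IsBetween y z x := by
  unfold IsBetween at *
  rw [dist_comm y z, dist_comm z x, dist_comm y x]; linarith

theorem map (g : X ≃ᵢ X) (h : IsBetween x z y) : IsBetween (g x) (g z) (g y) := by
  simpa [IsBetween, g.dist_eq] using h

end IsBetween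

namespace IsTreeLike

variable {X : Type u} [MetricSpace X] (hX : IsTreeLike X)

include hX

/-- The path from `y` joins `[a, b]` on one side of `z`, hence crosses `z` on its way to the
opposite end. -/
theorem between_or {a b z : X} (h : IsBetween a z b) (y : X) :
    IsBetween y z a ∨ IsBetween y z b := by
  have h4 := hX.four_point y z a b
  unfold IsBetween at *
  have h1 := dist_triangle y z a
  have h2 := dist_triangle y z b
  rw [dist_comm a z] at h
  rcases le_max_iff.1 h4 with h5 | h5
  · left; linarith
  · right; linarith

theorem eq_of_between {a b z w : X} (hz : IsBetween a z b) (hw : IsBetween a w b)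
    (h : dist a z = dist a w) : z = w := by
  have h4 := hX.four_point z w a b
  unfold IsBetween at *
  rw [dist_comm z a, dist_comm w a] at h4
  refine dist_le_zero.1 ?_
  rcases le_max_iff.1 h4 with h5 | h5 <;> linarith

theorem dist_of_between {a b z w : X} (hz : IsBetween a z b) (hw : IsBetween a w b) :
    dist z w = |dist a z - dist a w| := by
  rcases hX.between_or hz w with h | h
  · unfold IsBetween at h
    rw [dist_comm w z, dist_comm z a, dist_comm w a] at h
    rw [abs_sub_comm, abs_of_nonneg] <;> linarith [dist_nonneg (x := z) (y := w)]
  · unfold IsBetween at *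
    rw [dist_comm w z] at h
    rw [abs_of_nonneg] <;> linarith [dist_nonneg (x := z) (y := w)]

/-- Points of `[x, y]` at distance at most the Gromov product from `x` lie on `[x, z]`. -/
theorem between_of_le_gromov {x y z u : X} (hu : IsBetween x u y)
    (h : 2 * dist x u ≤ dist x y + dist x z - dist y z) : IsBetween x u z := by
  have h4 := hX.four_point u z x y
  have h1 := dist_triangle x u z
  unfold IsBetween at *
  rw [dist_comm u x, dist_comm z y, dist_comm z x] at h4
  rcases le_max_iff.1 h4 with h5 | h5 <;> linarith

omit hX in
theorem gromov_of_between {x y z u : X} (hu : IsBetween x u y) (hu' : IsBetween x u z) :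
    2 * dist x u ≤ dist x y + dist x z - dist y z := by
  have := dist_triangle y u z
  unfold IsBetween at *
  rw [dist_comm y u] at this
  linarith

theorem isSegmentBetween_interval (x y : X) : IsSegmentBetween x y {z | IsBetween x z y} := by
  have hex : ∀ s : ℝ, ∃ z : X, s ∈ Set.Icc 0 (dist x y) → dist x z = s ∧ IsBetween x z y := by
    intro s
    by_cases hs : s ∈ Set.Icc 0 (dist x y)
    · obtain ⟨z, h1, h2⟩ := hX.exists_between x y s hs.1 hs.2
      exact ⟨z, fun _ => ⟨h1, by unfold IsBetween; linarith⟩⟩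
    · exact ⟨x, fun h => absurd h hs⟩
  choose γ hγ using hex
  have h0 : (0 : ℝ) ∈ Set.Icc 0 (dist x y) := ⟨le_rfl, dist_nonneg⟩
  have hl : dist x y ∈ Set.Icc 0 (dist x y) := ⟨dist_nonneg, le_rfl⟩
  refine ⟨dist x y, γ, dist_nonneg, ?_, ?_, ?_, ?_⟩
  · intro s hs t ht
    rw [hX.dist_of_between (hγ s hs).2 (hγ t ht).2, (hγ s hs).1, (hγ t ht).1]
  · exact (dist_eq_zero.1 (hγ 0 h0).1).symm
  · have h := (hγ _ hl).2
    unfold IsBetween at h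
    rw [(hγ _ hl).1] at h
    exact dist_eq_zero.1 (by linarith)
  · ext z
    simp only [Set.mem_ofPred_eq, Set.mem_image]
    constructor
    · intro hz
      have hm : dist x z ∈ Set.Icc 0 (dist x y) := by
        refine ⟨dist_nonneg, ?_⟩
        unfold IsBetween at hz
        linarith [dist_nonneg (x := z) (y := y)]
      exact ⟨_, hm, hX.eq_of_between (hγ _ hm).2 hz (hγ _ hm).1⟩
    · rintro ⟨s, hs, rfl⟩
      exact (hγ s hs).2

/-- Uniqueness of segments: it turns the axioms of an `ℝ`-tree into statements about betweenness. -/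
theorem eq_interval {x y : X} {S : Set X} (hS : IsSegmentBetween x y S) :
    S = {z | IsBetween x z y} := by
  obtain ⟨l, γ, hl, hγ, h0, h1, rfl⟩ := hS
  have m0 : (0 : ℝ) ∈ Set.Icc 0 l := ⟨le_rfl, hl⟩
  have ml : l ∈ Set.Icc 0 l := ⟨hl, le_rfl⟩
  have hxy : dist x y = l := by
    rw [← h0, ← h1, hγ 0 m0 l ml, zero_sub, abs_neg, abs_of_nonneg hl]
  have hx : ∀ s ∈ Set.Icc 0 l, dist x (γ s) = s := fun s hs => by
    rw [← h0, hγ 0 m0 s hs, zero_sub, abs_neg, abs_of_nonneg hs.1]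
  have hy : ∀ s ∈ Set.Icc 0 l, dist (γ s) y = l - s := fun s hs => by
    rw [← h1, hγ s hs l ml, abs_sub_comm, abs_of_nonneg (by linarith [hs.2])]
  have hb : ∀ s ∈ Set.Icc 0 l, IsBetween x (γ s) y := fun s hs => by
    unfold IsBetween
    rw [hx s hs, hy s hs, hxy]; ring
  ext z
  constructor
  · rintro ⟨s, hs, rfl⟩
    exact hb s hs
  · intro hz
    have hm : dist x z ∈ Set.Icc 0 l := by
      refine ⟨dist_nonneg, ?_⟩
      have hz' : dist x z + dist z y = dist x y := hz
      linarith [dist_nonneg (x := z) (y := y)]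
    exact ⟨_, hm, hX.eq_of_between (hb _ hm) hz (hx _ hm)⟩

theorem isRealTree : IsRealTree X where
  geodesic x y := ⟨_, hX.isSegmentBetween_interval x y⟩
  union x y z S S' hS hS' hSS' := by
    rw [hX.eq_interval hS, hX.eq_interval hS'] at *
    have hxyz : IsBetween x y z := by
      have hd := dist_triangle x y z
      -- The branch point of `x, y, z`, placed on `[y, x]` at the Gromov product from `y`, lies on
      -- both segments. It must be `y`, so the Gromov product vanishes.
      obtain ⟨m, hm1, hm2⟩ := hX.exists_between y x ((dist y x + dist y z - dist x z) / 2)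
        (by rw [dist_comm y x]; linarith)
        (by linarith [dist_triangle y x z])
      have hmx : IsBetween y m x := by unfold IsBetween; linarith
      have hmz : IsBetween y m z := hX.between_of_le_gromov hmx (by linarith)
      have : m ∈ ({y} : Set X) := hSS' ▸ ⟨hmx.symm, hmz⟩
      rw [Set.mem_singleton_iff] at this
      rw [this, dist_self] at hm1
      unfold IsBetween
      rw [dist_comm x y]; linarith
    have : {w | IsBetween x w y} ∪ {w | IsBetween y w z} = {w | IsBetween x w z} := by
      ext w
      simp only [Set.mem_union, Set.mem_ofPred_eq]
      constructor
      · have h1 := dist_triangle x w z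
        unfold IsBetween at *
        rintro (h | h)
        · linarith [dist_triangle w y z]
        · linarith [dist_triangle x y w]
      · intro h
        have h2 := hX.dist_of_between h hxyz
        rcases le_total (dist x w) (dist x y) with h3 | h3
        · left
          rw [abs_of_nonpos (by linarith)] at h2
          unfold IsBetween; linarith
        · right
          rw [abs_of_nonneg (by linarith), dist_comm] at h2
          unfold IsBetween at *; linarith
    rw [this]
    exact ⟨x, z, hX.isSegmentBetween_interval x z⟩
  inter x y z S S' hS hS' := by
    rw [hX.eq_interval hS, hX.eq_interval hS']
    -- The branch point again: the two segments share exactly the part from `x` to `m`.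
    obtain ⟨m, hm1, hm2⟩ := hX.exists_between x y ((dist x y + dist x z - dist y z) / 2)
      (by linarith [dist_triangle y x z, dist_comm y x])
      (by linarith [dist_triangle x y z])
    have hmy : IsBetween x m y := by unfold IsBetween; linarith
    have : {w | IsBetween x w y} ∩ {w | IsBetween x w z} = {w | IsBetween x w m} := by
      ext w
      simp only [Set.mem_inter_iff, Set.mem_ofPred_eq]
      constructor
      · rintro ⟨h1, h2⟩
        have h3 := gromov_of_between h1 h2
        have h4 := hX.dist_of_between h1 hmy
        rw [abs_of_nonpos (by linarith)] at h4
        unfold IsBetween; linarith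
      · intro h
        have hwy : IsBetween x w y := by
          have := dist_triangle w m y
          have := dist_triangle x w y
          unfold IsBetween at *; linarith
        refine ⟨hwy, hX.between_of_le_gromov hwy ?_⟩
        unfold IsBetween at h
        linarith [dist_nonneg (x := w) (y := m)]
    rw [this]
    exact ⟨x, m, hX.isSegmentBetween_interval x m⟩

/-- A positive Gromov product based at `x` is invariant under joining by segments avoiding `x`. -/
theorem gromov_pos_of_segment {x y z : X} {S : Set X} (hS : IsSegmentBetween y z S)
    (hx : x ∉ S) : dist y z < dist x y + dist x z := by
  rw [hX.eq_interval hS] at hx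
  have h := dist_triangle y x z
  rw [dist_comm y x] at h
  refine lt_of_le_of_ne h fun h' => hx ?_
  change dist y x + dist x z = dist y z
  rw [dist_comm y x, h']

/-- Gromov products based at `x` satisfy the ultrametric inequality, so positivity is transitive. -/
theorem gromov_pos_trans {x y z w : X} (h1 : dist y z < dist x y + dist x z)
    (h2 : dist z w < dist x z + dist x w) : dist y w < dist x y + dist x w := by
  have := hX.four_point y w x z
  rw [dist_comm y x, dist_comm w z, dist_comm w x] at this
  rcases le_max_iff.1 this with h | h <;> linarith

/-- A family of points pairwise separated by `x` gives a lower bound for the valence at `x`. -/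
theorem le_mk_direction {ι : Type u} {x : X} (f : ι → X) (hne : ∀ i, f i ≠ x)
    (hf : ∀ i j, i ≠ j → dist (f i) (f j) = dist x (f i) + dist x (f j)) :
    Cardinal.mk ι ≤ Cardinal.mk (Direction x) := by
  let s : Setoid {w : X // w ≠ x} :=
    { r := fun y z => dist (y : X) z < dist x y + dist x z
      iseqv :=
        { refl := fun y => by
            have : 0 < dist x (y : X) := dist_pos.2 y.2.symm
            rw [dist_self]; linarith
          symm := fun {y z} h => by rw [dist_comm]; linarith
          trans := fun h h' => hX.gromov_pos_trans h h' } }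
  let φ : Direction x → Quotient s :=
    Quot.lift (fun y => Quotient.mk s y) fun y z ⟨S, hS, hxS⟩ =>
      Quotient.sound (hX.gromov_pos_of_segment hS hxS)
  refine Cardinal.mk_le_of_injective (f := fun i => Quot.mk _ ⟨f i, hne i⟩) fun i j hij => ?_
  by_contra hne'
  have h : φ (Quot.mk _ ⟨f i, hne i⟩) = φ (Quot.mk _ ⟨f j, hne j⟩) := congrArg φ hij
  have h' : dist (f i) (f j) < dist x (f i) + dist x (f j) := Quotient.exact h
  linarith [hf i j hne']

/-! ### Axes of isometries -/

/-- `q` swaps the ends of `[x, q x]`, hence fixes its midpoint. -/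
theorem exists_midpoint_fixed {q : X ≃ᵢ X} {x : X} (h : q (q x) = x) : ∃ m, q m = m := by
  obtain ⟨m, h1, h2⟩ := hX.exists_between x (q x) (dist x (q x) / 2)
    (by linarith [dist_nonneg (x := x) (y := q x)])
    (by linarith [dist_nonneg (x := x) (y := q x)])
  have hm : IsBetween x m (q x) := by unfold IsBetween; linarith
  refine ⟨m, hX.eq_of_between (a := x) (b := q x) ?_ hm ?_⟩
  · have := (hm.map q).symm
    rwa [h] at this
  · calc dist x (q m) = dist (q (q x)) (q m) := by rw [h]
      _ = dist (q x) m := q.dist_eq _ _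
      _ = dist x m := by rw [dist_comm]; linarith

/-- The midpoint `m` of `[x, p x]` works. Any other position of `p m` relative to `m` and `p (p m)`
would force a fixed point. -/
theorem axisSet_nonempty {p : X ≃ᵢ X} (hp : ∀ x, p x ≠ x) (x : X) : (axisSet p).Nonempty := by
  obtain ⟨m, h1, h2⟩ := hX.exists_between x (p x) (dist x (p x) / 2)
    (by linarith [dist_nonneg (x := x) (y := p x)])
    (by linarith [dist_nonneg (x := x) (y := p x)])
  have hm : IsBetween x m (p x) := by unfold IsBetween; linarith
  have h3 : dist (p m) (p x) = dist x (p x) / 2 := by rw [p.dist_eq, dist_comm, h1]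
  have h4 : dist (p m) (p (p x)) = dist x (p x) / 2 := by rw [p.dist_eq]; linarith
  have h5 : dist (p (p m)) (p (p x)) = dist x (p x) / 2 := by rw [p.dist_eq, h3]
  have hk : IsBetween m (p m) (p (p x)) := by
    rcases hX.between_or (hm.map p) m with h | h
    · unfold IsBetween at h
      exact absurd (dist_le_zero.1 (by linarith : dist m (p m) ≤ 0)).symm (hp m)
    · exact h
  refine ⟨m, ?_⟩
  rcases hX.between_or hk (p (p m)) with h | h
  · unfold IsBetween at h
    have : dist (p (p m)) (p m) = dist m (p m) := by rw [p.dist_eq, dist_comm]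
    change dist m (p (p m)) = _
    rw [dist_comm m (p (p m)), ← h, this, dist_comm (p m) m]; ring
  · unfold IsBetween at h
    have h6 : dist (p (p m)) (p m) ≤ 0 := by linarith
    exact absurd (dist_le_zero.1 h6) (hp (p m))

/-- Local geodesics in a tree are geodesics: the four point inequality on `z` and three consecutive
translates extends additivity by one step. -/
theorem dist_pow_of_mem_axisSet {p : X ≃ᵢ X} (hp : ∀ x, p x ≠ x) {z : X} (hz : z ∈ axisSet p)
    (n : ℕ) : dist z ((p ^ n) z) = n * dist z (p z) := by
  have ht : 0 < dist z (p z) := dist_pos.2 (hp z).symm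
  have hz' : dist z (p (p z)) = 2 * dist z (p z) := hz
  have hs : ∀ n : ℕ, ∀ w, (p ^ (n + 1)) w = (p ^ n) (p w) := fun n w => by rw [pow_succ]; rfl
  induction n using Nat.strong_induction_on with
  | _ n ih =>
    match n with
    | 0 => simp
    | 1 => simp
    | n + 2 =>
      have h0 := ih n (by omega)
      have h1 := ih (n + 1) (by omega)
      have e1 : dist ((p ^ n) z) ((p ^ (n + 1)) z) = dist z (p z) := by
        rw [hs, (p ^ n).dist_eq]
      have e2 : dist ((p ^ (n + 1)) z) ((p ^ (n + 2)) z) = dist z (p z) := by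
        rw [hs (n + 1), (p ^ (n + 1)).dist_eq]
      have e3 : dist ((p ^ n) z) ((p ^ (n + 2)) z) = 2 * dist z (p z) := by
        rw [hs (n + 1), hs n, (p ^ n).dist_eq, hz']
      have h4 := hX.four_point z ((p ^ (n + 1)) z) ((p ^ n) z) ((p ^ (n + 2)) z)
      have h5 := dist_triangle z ((p ^ (n + 1)) z) ((p ^ (n + 2)) z)
      rw [dist_comm ((p ^ (n + 1)) z) ((p ^ n) z), e1, e2, e3, h0, h1] at h4
      rw [e2, h1] at h5
      push_cast at *
      rcases le_max_iff.1 h4 with h | h <;> nlinarith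

theorem exists_between_pow {p : X ≃ᵢ X} (hp : ∀ x, p x ≠ x) {z : X} (hz : z ∈ axisSet p)
    (f : X) : ∃ N : ℕ, ∀ n ≥ N, IsBetween ((p ^ n)⁻¹ f) z ((p ^ n) f) := by
  have ht : 0 < dist z (p z) := dist_pos.2 (hp z).symm
  -- Once `n` translation lengths exceed `dist z f`, the detours from the axis to the translates of
  -- `f` are too short to reach back to `z`.
  obtain ⟨N, hN⟩ := exists_nat_gt (dist z f / dist z (p z))
  rw [div_lt_iff₀ ht] at hN
  refine ⟨N, fun n hNn => ?_⟩
  have hn : dist z f < n * dist z (p z) :=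
    hN.trans_le (mul_le_mul_of_nonneg_right (Nat.cast_le.2 hNn) ht.le)
  have e : ∀ w, (p ^ n) ((p ^ n)⁻¹ w) = w := fun w => (p ^ n).apply_symm_apply w
  have h1 : dist z ((p ^ n) z) = n * dist z (p z) := hX.dist_pow_of_mem_axisSet hp hz n
  have h2 : dist ((p ^ n)⁻¹ z) z = n * dist z (p z) := by
    rw [← (p ^ n).dist_eq, e, h1]
  have h3 : dist ((p ^ n)⁻¹ z) ((p ^ n) z) = 2 * (n * dist z (p z)) := by
    rw [← (p ^ n).dist_eq, e]
    have := hX.dist_pow_of_mem_axisSet hp hz (n + n)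
    rw [pow_add] at this
    push_cast at this
    calc _ = (n + n) * dist z (p z) := this
      _ = _ := by ring
  have hb : IsBetween ((p ^ n)⁻¹ z) z ((p ^ n) z) := by unfold IsBetween; linarith
  have h4 : dist ((p ^ n)⁻¹ f) ((p ^ n)⁻¹ z) ≤ dist z f := by
    rw [← (p ^ n).dist_eq, e, e, dist_comm]
  have h5 : dist ((p ^ n) f) ((p ^ n) z) ≤ dist z f := by
    rw [(p ^ n).dist_eq, dist_comm]
  have hb2 : IsBetween ((p ^ n)⁻¹ f) z ((p ^ n) z) := by
    rcases hX.between_or hb ((p ^ n)⁻¹ f) with h | h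
    · unfold IsBetween at h
      rw [dist_comm z] at h
      linarith [dist_nonneg (x := (p ^ n)⁻¹ f) (y := z)]
    · exact h
  rcases hX.between_or hb2 ((p ^ n) f) with h | h
  · exact h.symm
  · unfold IsBetween at h
    linarith [dist_nonneg (x := (p ^ n) f) (y := z)]

/-- An isometry with a fixed point which commutes with a fixed point free isometry fixes the
axis of the latter pointwise. -/
theorem fixes_axisSet {p q : X ≃ᵢ X} (hp : ∀ x, p x ≠ x) (h : Commute p q) {f : X}
    (hf : q f = f) {z : X} (hz : z ∈ axisSet p) : q z = z := by
  obtain ⟨n, hn⟩ := hX.exists_between_pow hp hz f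
  have hb := hn n le_rfl
  have h1 : q ((p ^ n) f) = (p ^ n) f := by
    have : q * p ^ n = p ^ n * q := (h.symm.pow_right n).eq
    have := DFunLike.congr_fun this f
    change q ((p ^ n) f) = (p ^ n) (q f) at this
    rw [this, hf]
  have h2 : q ((p ^ n)⁻¹ f) = (p ^ n)⁻¹ f := by
    have : q * (p ^ n)⁻¹ = (p ^ n)⁻¹ * q := ((h.symm.pow_right n).inv_right).eq
    have := DFunLike.congr_fun this f
    change q ((p ^ n)⁻¹ f) = (p ^ n)⁻¹ (q f) at this
    rw [this, hf]
  have hb' := hb.map q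
  rw [h1, h2] at hb'
  refine hX.eq_of_between hb' hb ?_
  conv_lhs => rw [← h2]
  exact q.dist_eq _ _

/-- The points `x`, `q x`, `q (q x)` stay on the axis of `p`, so lie on a common segment, with equal
consecutive gaps. Either they progress in one direction, or `q (q x) = x` and `q` fixes a midpoint.
-/
theorem axisSet_subset {p q : X ≃ᵢ X} (hp : ∀ x, p x ≠ x) (hq : ∀ x, q x ≠ x)
    (h : Commute p q) : axisSet p ⊆ axisSet q := by
  intro x hx
  have hx1 := mem_axisSet_of_commute h hx
  obtain ⟨n₀, h0⟩ := hX.exists_between_pow hp hx x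
  obtain ⟨n₁, h1⟩ := hX.exists_between_pow hp hx1 x
  obtain ⟨n₂, h2⟩ := hX.exists_between_pow hp (mem_axisSet_of_commute h hx1) x
  obtain ⟨n, hn0, hn1, hn2⟩ : ∃ n, n₀ ≤ n ∧ n₁ ≤ n ∧ n₂ ≤ n :=
    ⟨max n₀ (max n₁ n₂), by simp, by simp, by simp⟩
  replace h0 := h0 n hn0
  replace h1 := h1 n hn1
  replace h2 := h2 n hn2
  have d01 := hX.dist_of_between h0 h1
  have d12 := hX.dist_of_between h1 h2
  have d02 := hX.dist_of_between h0 h2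
  rw [q.dist_eq] at d12
  have hne : dist x (q (q x)) ≠ 0 := fun h' => by
    obtain ⟨m, hm⟩ := hX.exists_midpoint_fixed (dist_eq_zero.1 h').symm
    exact hq m hm
  change dist x (q (q x)) = 2 * dist x (q x)
  rw [d02] at hne ⊢
  have hne' := abs_pos.1 (lt_of_le_of_ne (abs_nonneg _) hne.symm)
  rw [d01] at d12
  rcases abs_eq_abs.1 d12 with h3 | h3
  · rw [d01, h3, ← abs_two, ← abs_mul]
    congr 1
    linarith
  · exact absurd (by linarith) hne'

/-- The displacements of `p ^ n` at `z` and `w` grow linearly in `n` and differ by at most `2 * dist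
z w`. -/
theorem translation_le {p : X ≃ᵢ X} (hp : ∀ x, p x ≠ x) {z w : X} (hz : z ∈ axisSet p)
    (hw : w ∈ axisSet p) : dist z (p z) ≤ dist w (p w) := by
  by_contra! hlt
  obtain ⟨n, hn⟩ := exists_nat_gt (2 * dist z w / (dist z (p z) - dist w (p w)))
  rw [div_lt_iff₀ (by linarith)] at hn
  have h1 := hX.dist_pow_of_mem_axisSet hp hz n
  have h2 := hX.dist_pow_of_mem_axisSet hp hw n
  have h3 := dist_triangle4 z w ((p ^ n) w) ((p ^ n) z)
  rw [(p ^ n).dist_eq, dist_comm w z] at h3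
  linarith

/-- If two commuting sets of isometries both contain a fixed point free isometry and together
act coboundedly, then the displacement of such an isometry is bounded. -/
theorem displacement_bounded {P Q : Set (X ≃ᵢ X)} (hPQ : ∀ p ∈ P, ∀ q ∈ Q, Commute p q)
    {p₀ q₀ : X ≃ᵢ X} (hp₀ : p₀ ∈ P) (hq₀ : q₀ ∈ Q) (hp : ∀ x, p₀ x ≠ x) (hq : ∀ x, q₀ x ≠ x)
    {o : X} {R : ℝ} (hR : ∀ y, ∃ p ∈ P, ∃ q ∈ Q, dist y (p (q o)) ≤ R) :
    ∃ M, ∀ y, dist y (p₀ y) ≤ M := by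
  have h0 := hPQ p₀ hp₀ q₀ hq₀
  obtain ⟨z, hz⟩ := hX.axisSet_nonempty hp o
  have hsub := hX.axisSet_subset hq hp h0.symm
  have hsub' := hX.axisSet_subset hp hq h0
  have hz' := hsub' hz
  -- The common axis of `p₀` and `q₀` is preserved by `Q`, which commutes with `p₀`, and by `P`,
  -- which commutes with `q₀`.
  have key : ∀ p ∈ P, ∀ q ∈ Q, dist (p (q z)) (p₀ (p (q z))) = dist z (p₀ z) := by
    intro p hpP q hqQ
    have hm : p (q z) ∈ axisSet p₀ := hsub <| mem_axisSet_of_commute (hPQ p hpP q₀ hq₀).symm <|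
      hsub' <| mem_axisSet_of_commute (hPQ p₀ hp₀ q hqQ) hz
    exact le_antisymm (hX.translation_le hp hm hz) (hX.translation_le hp hz hm)
  refine ⟨2 * (R + dist o z) + dist z (p₀ z), fun y => ?_⟩
  obtain ⟨p, hpP, q, hqQ, h⟩ := hR y
  have h1 : dist (p (q o)) (p (q z)) = dist o z := by rw [p.dist_eq, q.dist_eq]
  have h2 := dist_triangle y (p (q o)) (p (q z))
  have h3 := dist_triangle4 y (p (q z)) (p₀ (p (q z))) (p₀ y)
  rw [p₀.dist_eq, key p hpP q hqQ, dist_comm (p (q z)) y] at h3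
  linarith

end IsTreeLike

/-! ### Reduced paths -/

/-- A `1`-Lipschitz path `[0, len] → V` starting at `0` (extended to `ℝ` by constants) which
does not backtrack at any interior time. -/
@[ext]
structure ReducedPath (V : Type*) [NormedAddCommGroup V] where
  toFun : ℝ → V
  len : ℝ
  len_nonneg : 0 ≤ len
  lipschitz : ∀ s t, s ≤ t → ‖toFun t - toFun s‖ ≤ t - s
  of_nonpos : ∀ t ≤ 0, toFun t = 0
  of_len_le : ∀ t, len ≤ t → toFun t = toFun len
  reduced : ∀ t, 0 < t → t < len → ∀ ε > 0, ∃ s, 0 < s ∧ s < ε ∧ toFun (t + s) ≠ toFun (t - s)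

namespace ReducedPath

variable {V : Type*} [NormedAddCommGroup V]

instance : CoeFun (ReducedPath V) fun _ => ℝ → V := ⟨toFun⟩

theorem norm_sub_le (F : ReducedPath V) (s t : ℝ) : ‖F t - F s‖ ≤ |t - s| := by
  rcases le_total s t with h | h
  · rw [abs_of_nonneg (by linarith)]; exact F.lipschitz s t h
  · rw [norm_sub_rev, abs_sub_comm, abs_of_nonneg (by linarith)]; exact F.lipschitz t s h

theorem continuous (F : ReducedPath V) : Continuous F :=
  (LipschitzWith.of_dist_le_mul (K := 1) fun s t => by
    rw [dist_eq_norm, Real.dist_eq, NNReal.coe_one, one_mul]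
    exact F.norm_sub_le t s).continuous

/-- The end point of a path. -/
def endpoint (F : ReducedPath V) : V := F F.len

theorem ext_of_le {F G : ReducedPath V} (hlen : F.len = G.len)
    (h : ∀ t, 0 ≤ t → t ≤ F.len → F t = G t) : F = G := by
  refine ReducedPath.ext (funext fun t => ?_) hlen
  rcases le_total t 0 with h0 | h0
  · rw [F.of_nonpos t h0, G.of_nonpos t h0]
  rcases le_total t F.len with h1 | h1
  · exact h t h0 h1
  · rw [F.of_len_le t h1, G.of_len_le t (hlen ▸ h1), ← hlen, h _ F.len_nonneg le_rfl]

/-- The length of the longest common initial subpath. -/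
noncomputable def agree (F G : ReducedPath V) : ℝ :=
  sSup {s | s ≤ F.len ∧ s ≤ G.len ∧ ∀ u < s, F u = G u}

section agree

variable (F G H : ReducedPath V)

theorem zero_mem_agree :
    (0 : ℝ) ∈ {s | s ≤ F.len ∧ s ≤ G.len ∧ ∀ u < s, F u = G u} :=
  ⟨F.len_nonneg, G.len_nonneg, fun u hu => by rw [F.of_nonpos u hu.le, G.of_nonpos u hu.le]⟩

theorem bddAbove_agree : BddAbove {s | s ≤ F.len ∧ s ≤ G.len ∧ ∀ u < s, F u = G u} :=
  ⟨F.len, fun _ h => h.1⟩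

theorem agree_nonneg : 0 ≤ agree F G := le_csSup (bddAbove_agree F G) (zero_mem_agree F G)

theorem agree_le_left : agree F G ≤ F.len := csSup_le ⟨0, zero_mem_agree F G⟩ fun _ h => h.1

theorem agree_le_right : agree F G ≤ G.len := csSup_le ⟨0, zero_mem_agree F G⟩ fun _ h => h.2.1

variable {F G H}

theorem le_agree {s : ℝ} (h1 : s ≤ F.len) (h2 : s ≤ G.len)
    (h : ∀ u, 0 < u → u < s → F u = G u) : s ≤ agree F G := by
  refine le_csSup (bddAbove_agree F G) ⟨h1, h2, fun u hu => ?_⟩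
  rcases le_or_gt u 0 with h0 | h0
  · rw [F.of_nonpos u h0, G.of_nonpos u h0]
  · exact h u h0 hu

/-- Continuity: the supremum is attained. -/
theorem eq_of_le_agree {u : ℝ} (hu : u ≤ agree F G) : F u = G u := by
  have hlt : Set.Iio (agree F G) ⊆ {u | F u = G u} := fun v hv => by
    obtain ⟨s, hs, hvs⟩ := exists_lt_of_lt_csSup ⟨0, zero_mem_agree F G⟩ hv
    exact hs.2.2 v hvs
  have := closure_minimal hlt (isClosed_eq F.continuous G.continuous)
  rw [closure_Iio] at this
  exact this hu

theorem agree_eq {s : ℝ} (h1 : s ≤ F.len) (h2 : s ≤ G.len)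
    (h : ∀ u, 0 < u → u < s → F u = G u)
    (h' : s < F.len → s < G.len → ∀ ε > 0, ∃ u, s < u ∧ u < s + ε ∧ F u ≠ G u) :
    agree F G = s := by
  refine le_antisymm ?_ (le_agree h1 h2 h)
  by_contra! hlt
  obtain ⟨u, hu1, hu2, hu⟩ := h' (hlt.trans_le (agree_le_left F G))
    (hlt.trans_le (agree_le_right F G)) (agree F G - s) (by linarith)
  exact hu (eq_of_le_agree (by linarith))

variable (F G H)

theorem exists_ne_of_agree_lt (h1 : agree F G < F.len) (h2 : agree F G < G.len) {ε : ℝ}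
    (hε : 0 < ε) : ∃ u, agree F G < u ∧ u < agree F G + ε ∧ F u ≠ G u := by
  by_contra! h
  have hle : min (min F.len G.len) (agree F G + ε) ≤ agree F G := by
    refine le_agree ((min_le_left _ _).trans (min_le_left _ _))
      ((min_le_left _ _).trans (min_le_right _ _)) fun u _ hu => ?_
    rcases le_or_gt u (agree F G) with h0 | h0
    · exact eq_of_le_agree h0
    · exact h u h0 (hu.trans_le (min_le_right _ _))
  have : agree F G < min (min F.len G.len) (agree F G + ε) :=
    lt_min (lt_min h1 h2) (by linarith)
  linarith

theorem agree_comm : agree F G = agree G F :=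
  le_antisymm
    (le_agree (agree_le_right _ _) (agree_le_left _ _) fun _ _ hu => (eq_of_le_agree hu.le).symm)
    (le_agree (agree_le_right _ _) (agree_le_left _ _) fun _ _ hu => (eq_of_le_agree hu.le).symm)

theorem agree_self : agree F F = F.len :=
  le_antisymm (agree_le_left F F) (le_agree le_rfl le_rfl fun _ _ _ => rfl)

/-- The ultrametric inequality behind both the triangle inequality and the four point inequality. -/
theorem min_agree_le : min (agree F G) (agree G H) ≤ agree F H :=
  le_agree ((min_le_left _ _).trans (agree_le_left _ _))
    ((min_le_right _ _).trans (agree_le_right _ _)) fun _ _ hu =>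
      (eq_of_le_agree (hu.le.trans (min_le_left _ _))).trans
        (eq_of_le_agree (hu.le.trans (min_le_right _ _)))

end agree

/-! ### The tree metric on reduced paths -/

noncomputable instance : MetricSpace (ReducedPath V) where
  dist F G := F.len + G.len - 2 * agree F G
  dist_self F := by rw [agree_self]; ring
  dist_comm F G := by rw [agree_comm]; ring
  dist_triangle F G H := by
    have h := min_agree_le F G H
    have := agree_le_right F G
    have := agree_le_left G H
    rcases min_le_iff.1 h with h | h <;> linarith
  eq_of_dist_eq_zero {F G} h := by
    have h1 := agree_le_left F G
    have h2 := agree_le_right F G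
    exact ext_of_le (by linarith) fun t _ ht => eq_of_le_agree (by linarith)

theorem dist_eq (F G : ReducedPath V) : dist F G = F.len + G.len - 2 * agree F G := rfl

theorem norm_sub_le_dist (F G : ReducedPath V) (t : ℝ) : ‖F t - G t‖ ≤ dist F G := by
  have h1 := agree_le_left F G
  have h2 := agree_le_right F G
  rw [dist_eq]
  rcases le_total t (agree F G) with h | h
  · rw [eq_of_le_agree h, sub_self, norm_zero]; linarith
  · have key : ∀ K : ReducedPath V, agree F G ≤ K.len →
        ‖K t - K (agree F G)‖ ≤ K.len - agree F G := fun K hK => by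
      rcases le_total t K.len with ht | ht
      · exact (K.lipschitz _ _ h).trans (by linarith)
      · rw [K.of_len_le t ht]; exact K.lipschitz _ _ hK
    calc ‖F t - G t‖ = ‖(F t - F (agree F G)) - (G t - G (agree F G))‖ := by
          rw [eq_of_le_agree (F := F) (G := G) le_rfl]; congr 1; abel
      _ ≤ ‖F t - F (agree F G)‖ + ‖G t - G (agree F G)‖ := _root_.norm_sub_le _ _
      _ ≤ _ := by linarith [key F h1, key G h2]

theorem abs_len_sub_le_dist (F G : ReducedPath V) : |F.len - G.len| ≤ dist F G := by
  have h1 := agree_le_left F G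
  have h2 := agree_le_right F G
  rw [dist_eq, abs_le]
  constructor <;> linarith

theorem norm_endpoint_sub_le (F G : ReducedPath V) : ‖F.endpoint - G.endpoint‖ ≤ dist F G := by
  have h1 := F.of_len_le (max F.len G.len) (le_max_left _ _)
  have h2 := G.of_len_le (max F.len G.len) (le_max_right _ _)
  unfold endpoint
  rw [← h1, ← h2]
  exact norm_sub_le_dist F G _

/-- The initial subpath of length `r`. -/
def take (F : ReducedPath V) (r : ℝ) (h0 : 0 ≤ r) (h1 : r ≤ F.len) : ReducedPath V where
  toFun t := F (min t r)
  len := r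
  len_nonneg := h0
  lipschitz s t hst := (F.norm_sub_le _ _).trans <|
    (abs_min_sub_min_le_max _ _ _ _).trans (by simp [abs_of_nonneg, hst])
  of_nonpos t ht := F.of_nonpos _ ((min_le_left _ _).trans ht)
  of_len_le t ht := by rw [min_eq_right ht, min_self]
  reduced t ht0 htr ε hε := by
    obtain ⟨s, hs0, hs1, hs⟩ := F.reduced t ht0 (htr.trans_le h1) (min ε (r - t))
      (lt_min hε (by linarith))
    have := hs1.trans_le (min_le_right _ _)
    refine ⟨s, hs0, hs1.trans_le (min_le_left _ _), ?_⟩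
    rwa [min_eq_left (by linarith), min_eq_left (by linarith)]

section take

variable (F G : ReducedPath V) {r : ℝ} (h0 : 0 ≤ r) (h1 : r ≤ F.len)

theorem take_apply {t : ℝ} (ht : t ≤ r) : F.take r h0 h1 t = F t := by
  change F (min t r) = _
  rw [min_eq_left ht]

theorem take_len : (F.take r h0 h1).len = r := rfl

theorem take_endpoint : (F.take r h0 h1).endpoint = F r := take_apply F h0 h1 le_rfl

theorem agree_take : agree F (F.take r h0 h1) = r :=
  le_antisymm (agree_le_right _ _)
    (le_agree h1 le_rfl fun _ _ hu => (take_apply F h0 h1 hu.le).symm)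

theorem dist_take : dist F (F.take r h0 h1) = F.len - r := by
  rw [dist_eq, agree_take, take_len]; ring

end take

instance : Zero (ReducedPath V) :=
  ⟨{ toFun := fun _ => 0
     len := 0
     len_nonneg := le_rfl
     lipschitz := fun s t h => by simpa using h
     of_nonpos := fun _ _ => rfl
     of_len_le := fun _ _ => rfl
     reduced := fun t h h' => by linarith }⟩

theorem zero_len : (0 : ReducedPath V).len = 0 := rfl

theorem endpoint_zero : (0 : ReducedPath V).endpoint = 0 := rfl

theorem agree_zero (F : ReducedPath V) : agree 0 F = 0 :=
  le_antisymm (agree_le_left 0 F) (agree_nonneg 0 F)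

theorem dist_zero (F : ReducedPath V) : dist 0 F = F.len := by
  rw [dist_eq, agree_zero, zero_len]; ring

theorem isTreeLike : IsTreeLike (ReducedPath V) where
  four_point x y z w := by
    simp only [dist_eq]
    have a1 := min_agree_le x z y
    have a2 := min_agree_le x w y
    have a3 := min_agree_le z x w
    have a4 := min_agree_le z y w
    rw [agree_comm z x] at a3
    rw [agree_comm z y] at a1 a4
    rw [agree_comm w y] at a2
    rw [le_max_iff]
    rcases min_le_iff.1 a1 with a1 | a1 <;> rcases min_le_iff.1 a2 with a2 | a2 <;>
      rcases min_le_iff.1 a3 with a3 | a3 <;> rcases min_le_iff.1 a4 with a4 | a4 <;>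
      first
        | (left; linarith)
        | (right; linarith)
        | (rcases le_total (agree x z) (agree y z) with h | h <;>
            rcases le_total (agree x w) (agree y w) with h' | h' <;>
            first
              | (left; linarith)
              | (right; linarith))
  exists_between F G s h0 h1 := by
    have c0 := agree_nonneg F G
    have c1 := agree_le_left F G
    have c2 := agree_le_right F G
    -- Shortening `F` beyond its branch point with `G` leaves the branch point alone. The required
    -- point is thus a truncation of `F` or of `G`, according to the side of the branch point.
    have key : ∀ (F G : ReducedPath V) (r : ℝ) (hr : agree F G ≤ r) (hr' : r ≤ F.len),
        agree (F.take r ((agree_nonneg F G).trans hr) hr') G = agree F G := by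
      intro F G r hr hr'
      refine le_antisymm ?_ ?_
      · refine le_agree ((agree_le_left _ _).trans hr') (agree_le_right _ _) fun u _ hu => ?_
        rw [← eq_of_le_agree hu.le, take_apply]
        exact hu.le.trans (agree_le_left _ _)
      · refine le_agree hr (agree_le_right _ _) fun _ _ hu => ?_
        rw [take_apply _ _ _ (hu.le.trans hr), eq_of_le_agree hu.le]
    rw [dist_eq] at h1
    rcases le_total s (F.len - agree F G) with h | h
    · have hr : agree F G ≤ F.len - s := by linarith
      refine ⟨F.take (F.len - s) (c0.trans hr) (by linarith), ?_, ?_⟩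
      · rw [dist_take]; ring
      · rw [dist_eq, key F G _ hr, take_len, dist_eq]; ring
    · have hr : agree G F ≤ G.len - (F.len + G.len - 2 * agree F G - s) := by
        rw [agree_comm]; linarith
      refine ⟨G.take (G.len - (F.len + G.len - 2 * agree F G - s))
        ((agree_nonneg _ _).trans hr) (by linarith), ?_, ?_⟩
      · rw [dist_comm, dist_eq, key G F _ hr, take_len, agree_comm G F]; ring
      · rw [dist_comm, dist_take, dist_eq]; ring

/-- The path with constant velocity `v` and length `l`. -/
def line [NormedSpace ℝ V] (v : V) (hv : v ≠ 0) (hv1 : ‖v‖ ≤ 1) (l : ℝ) (hl : 0 ≤ l) :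
    ReducedPath V where
  toFun t := max 0 (min t l) • v
  len := l
  len_nonneg := hl
  lipschitz s t hst := by
    rw [← sub_smul, norm_smul, Real.norm_eq_abs]
    refine (mul_le_of_le_one_right (abs_nonneg _) hv1).trans ?_
    refine (abs_max_sub_max_le_max _ _ _ _).trans ?_
    rw [sub_self, abs_zero, max_eq_right (abs_nonneg _)]
    exact (abs_min_sub_min_le_max _ _ _ _).trans (by simp [abs_of_nonneg, hst])
  of_nonpos t ht := by
    rw [max_eq_left ((min_le_left _ _).trans ht), zero_smul]
  of_len_le t ht := by rw [min_eq_right ht, min_self]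
  reduced t h0 h1 ε hε := by
    obtain ⟨s, hs0, hs1⟩ := exists_between (lt_min hε (lt_min h0 (sub_pos.2 h1)))
    obtain ⟨hsε, hs1⟩ := lt_min_iff.1 hs1
    obtain ⟨hst, hsl⟩ := lt_min_iff.1 hs1
    refine ⟨s, hs0, hsε, fun h => ?_⟩
    have := smul_left_injective ℝ hv h
    rw [min_eq_left (by linarith), min_eq_left (by linarith), max_eq_right (by linarith),
      max_eq_right (by linarith)] at this
    linarith

section line

variable [NormedSpace ℝ V] {v w : V} (hv : v ≠ 0) (hv1 : ‖v‖ ≤ 1) (hw : w ≠ 0) (hw1 : ‖w‖ ≤ 1)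
  {l l' : ℝ} (hl : 0 ≤ l) (hl' : 0 ≤ l')

theorem line_len : (line v hv hv1 l hl).len = l := rfl

theorem line_apply {t : ℝ} (h0 : 0 ≤ t) (h1 : t ≤ l) : line v hv hv1 l hl t = t • v := by
  change max 0 (min t l) • v = _
  rw [min_eq_left h1, max_eq_right h0]

theorem endpoint_line : (line v hv hv1 l hl).endpoint = l • v :=
  line_apply hv hv1 hl hl le_rfl

theorem dist_line_of_ne (hvw : v ≠ w) :
    dist (line v hv hv1 l hl) (line w hw hw1 l' hl') = l + l' := by
  have : agree (line v hv hv1 l hl) (line w hw hw1 l' hl') = 0 := by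
    refine agree_eq hl hl' (fun u hu hu' => by linarith) fun h h' ε hε => ?_
    rw [line_len] at h h'
    have hpos : 0 < min ε (min l l') := lt_min hε (lt_min h h')
    have e1 : min ε (min l l') ≤ ε := min_le_left _ _
    have e2 : min ε (min l l') ≤ l := (min_le_right _ _).trans (min_le_left _ _)
    have e3 : min ε (min l l') ≤ l' := (min_le_right _ _).trans (min_le_right _ _)
    refine ⟨min ε (min l l') / 2, by linarith, by linarith, fun h => hvw ?_⟩
    rw [line_apply _ _ _ (by linarith) (by linarith),
      line_apply _ _ _ (by linarith) (by linarith)] at h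
    exact smul_right_injective V (ne_of_gt (by linarith : 0 < min ε (min l l') / 2)) h
  rw [dist_eq, this, line_len, line_len]; ring

end line

open Filter Topology in
instance [CompleteSpace V] : CompleteSpace (ReducedPath V) := by
  refine Metric.complete_of_cauchySeq_tendsto fun x hx => ?_
  have hlim : ∀ t, ∃ a, Tendsto (fun n => x n t) atTop (𝓝 a) := fun t =>
    cauchySeq_tendsto_of_complete <| Metric.cauchySeq_iff.2 fun ε hε => by
      obtain ⟨N, hN⟩ := Metric.cauchySeq_iff.1 hx ε hε
      exact ⟨N, fun m hm n hn => by
        rw [dist_eq_norm]; exact (norm_sub_le_dist _ _ t).trans_lt (hN m hm n hn)⟩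
  choose F hF using hlim
  obtain ⟨L, hL⟩ : ∃ a, Tendsto (fun n => (x n).len) atTop (𝓝 a) :=
    cauchySeq_tendsto_of_complete <| Metric.cauchySeq_iff.2 fun ε hε => by
      obtain ⟨N, hN⟩ := Metric.cauchySeq_iff.1 hx ε hε
      exact ⟨N, fun m hm n hn => by
        rw [Real.dist_eq]; exact (abs_len_sub_le_dist _ _).trans_lt (hN m hm n hn)⟩
  -- Away from their ends the paths do not merely converge but eventually coincide with the limit,
  -- so absence of backtracking passes to the limit.
  have hagree : ∀ ε > 0, ∃ N, ∀ n ≥ N, |(x n).len - L| < ε ∧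
      ∀ u ≤ (x n).len - ε, x n u = F u := by
    intro ε hε
    obtain ⟨N, hN⟩ := Metric.cauchySeq_iff.1 hx ε hε
    obtain ⟨N', hN'⟩ := Metric.tendsto_atTop.1 hL ε hε
    refine ⟨max N N', fun n hn => ⟨hN' n ((le_max_right _ _).trans hn), fun u hu => ?_⟩⟩
    refine tendsto_nhds_unique (tendsto_const_nhds.congr' ?_) (hF u)
    filter_upwards [eventually_ge_atTop N] with m hm
    have h1 := hN n ((le_max_left _ _).trans hn) m hm
    have h2 := agree_le_right (x n) (x m)
    rw [dist_eq] at h1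
    exact eq_of_le_agree (by linarith)
  have hlip : ∀ s t, s ≤ t → ‖F t - F s‖ ≤ t - s := fun s t hst =>
    le_of_tendsto ((hF t).sub (hF s)).norm (Eventually.of_forall fun n => (x n).lipschitz s t hst)
  have hend : Tendsto (fun n => (x n).endpoint) atTop (𝓝 (F L)) := by
    have h1 : Tendsto (fun n => (x n).endpoint - x n L) atTop (𝓝 0) := by
      refine squeeze_zero_norm (a := fun n => |(x n).len - L|)
        (fun n => (x n).norm_sub_le _ _) ?_
      simpa using (hL.sub_const L).abs
    simpa using h1.add (hF L)
  let y : ReducedPath V :=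
    { toFun := F
      len := L
      len_nonneg := ge_of_tendsto' hL fun n => (x n).len_nonneg
      lipschitz := hlip
      of_nonpos := fun t ht => tendsto_nhds_unique (hF t)
        (tendsto_const_nhds.congr fun n => ((x n).of_nonpos t ht).symm)
      of_len_le := fun t ht => by
        rcases ht.eq_or_lt with rfl | ht
        · rfl
        refine tendsto_nhds_unique (hF t) (hend.congr' ?_)
        filter_upwards [hL.eventually (gt_mem_nhds ht)] with n hn
        exact ((x n).of_len_le t hn.le).symm
      reduced := fun t h0 h1 ε hε => by
        obtain ⟨N, hN⟩ := hagree ((L - t) / 4) (by linarith)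
        obtain ⟨h2, h3⟩ := hN N le_rfl
        rw [abs_lt] at h2
        obtain ⟨s, hs0, hs1, hs⟩ := (x N).reduced t h0 (by linarith) (min ε ((L - t) / 4))
          (lt_min hε (by linarith))
        have := hs1.trans_le (min_le_right _ _)
        refine ⟨s, hs0, hs1.trans_le (min_le_left _ _), ?_⟩
        rwa [← h3 _ (by linarith), ← h3 _ (by linarith)] }
  refine ⟨y, Metric.tendsto_atTop.2 fun ε hε => ?_⟩
  obtain ⟨N, hN⟩ := hagree (ε / 4) (by linarith)
  refine ⟨N, fun n hn => ?_⟩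
  obtain ⟨h1, h2⟩ := hN n hn
  rw [abs_lt] at h1
  have h3 : (x n).len - ε / 4 ≤ agree (x n) y :=
    le_agree (by linarith) (by change _ ≤ L; linarith) fun u _ hu => h2 u hu.le
  have h4 : y.len = L := rfl
  rw [dist_eq, h4]
  linarith

open Cardinal in
-- A continuous path is determined by its values at rational times.
theorem mk_le_continuum (W : Type) [NormedAddCommGroup W] (hW : #W ≤ 𝔠) :
    #(ReducedPath W) ≤ 𝔠 := by
  have hinj : Function.Injective fun F : ReducedPath W => (F.len, fun q : ℚ => F q) := by
    intro F G h
    simp only [Prod.mk.injEq] at h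
    refine ReducedPath.ext ?_ h.1
    exact Rat.denseRange_cast.equalizer F.continuous G.continuous h.2
  refine (mk_le_of_injective hinj).trans ?_
  have : #(ℚ → W) ≤ 𝔠 := by
    rw [← power_def, mk_eq_aleph0 ℚ]
    exact (power_le_power_right hW).trans (by simp)
  rw [mk_prod, lift_id, lift_id, mk_real]
  exact (mul_le_mul_right this _).trans (by simp)

end ReducedPath

/-! ### Reduced concatenation and left translations -/

namespace ReducedPath

variable {V : Type*} [NormedAddCommGroup V]

/-- The reversed path. -/
def inv (W : ReducedPath V) : ReducedPath V where
  toFun t := W (W.len - t) - W W.len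
  len := W.len
  len_nonneg := W.len_nonneg
  lipschitz s t hst := by
    rw [sub_sub_sub_cancel_right, norm_sub_rev]
    exact (W.lipschitz _ _ (by linarith)).trans (by linarith)
  of_nonpos t ht := by rw [W.of_len_le _ (by linarith), sub_self]
  of_len_le t ht := by rw [W.of_nonpos _ (by linarith), sub_self, W.of_nonpos _ le_rfl]
  reduced t h0 h1 ε hε := by
    obtain ⟨s, hs0, hs1, hs⟩ := W.reduced (W.len - t) (by linarith) (by linarith) ε hε
    refine ⟨s, hs0, hs1, fun h => hs ?_⟩
    have := sub_left_injective h
    rw [← sub_sub, ← sub_add] at this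
    exact this.symm

theorem inv_apply (W : ReducedPath V) (t : ℝ) : W.inv t = W (W.len - t) - W.endpoint := rfl

theorem inv_len (W : ReducedPath V) : W.inv.len = W.len := rfl

theorem endpoint_inv (W : ReducedPath V) : W.inv.endpoint = -W.endpoint := by
  change W (W.len - W.len) - _ = _
  rw [sub_self, W.of_nonpos 0 le_rfl, zero_sub]; rfl

theorem inv_inv (W : ReducedPath V) : W.inv.inv = W := by
  refine ReducedPath.ext (funext fun t => ?_) rfl
  rw [inv_apply, endpoint_inv, inv_apply, inv_len]
  simp

/-- The amount of cancellation between `W` and `F`. -/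
noncomputable def cancel (W F : ReducedPath V) : ℝ := agree W.inv F

section cancel

variable (W F : ReducedPath V)

theorem cancel_nonneg : 0 ≤ cancel W F := agree_nonneg _ _

theorem cancel_le_left : cancel W F ≤ W.len := agree_le_left W.inv F

theorem cancel_le_right : cancel W F ≤ F.len := agree_le_right _ _

theorem apply_sub_eq {u : ℝ} (hu : u ≤ cancel W F) : W (W.len - u) = W.endpoint + F u := by
  rw [← eq_of_le_agree (F := W.inv) (G := F) hu, inv_apply]; abel

/-- The function underlying `W.star F`. -/
noncomputable def starFun (t : ℝ) : V :=
  if t ≤ W.len - cancel W F then W t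
  else W.endpoint + F (t - W.len + 2 * cancel W F)

theorem starFun_of_le {t : ℝ} (ht : t ≤ W.len - cancel W F) : starFun W F t = W t := if_pos ht

theorem starFun_of_ge {t : ℝ} (ht : W.len - cancel W F ≤ t) :
    starFun W F t = W.endpoint + F (t - W.len + 2 * cancel W F) := by
  rcases ht.eq_or_lt with rfl | ht
  · rw [starFun_of_le _ _ le_rfl, apply_sub_eq W F le_rfl]
    congr 2; ring
  · exact if_neg (not_le.2 ht)

theorem starFun_lipschitz (s t : ℝ) (hst : s ≤ t) :
    ‖starFun W F t - starFun W F s‖ ≤ t - s := by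
  rcases le_total t (W.len - cancel W F) with ht | ht
  · rw [starFun_of_le _ _ ht, starFun_of_le _ _ (hst.trans ht)]
    exact W.lipschitz s t hst
  rcases le_total (W.len - cancel W F) s with hs | hs
  · rw [starFun_of_ge _ _ ht, starFun_of_ge _ _ hs, add_sub_add_left_eq_sub]
    exact (F.lipschitz _ _ (by linarith)).trans (by linarith)
  · have h1 : ‖starFun W F t - starFun W F (W.len - cancel W F)‖ ≤
        t - (W.len - cancel W F) := by
      rw [starFun_of_ge _ _ ht, starFun_of_ge _ _ le_rfl, add_sub_add_left_eq_sub]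
      exact (F.lipschitz _ _ (by linarith)).trans (by linarith)
    have h2 : ‖starFun W F (W.len - cancel W F) - starFun W F s‖ ≤ W.len - cancel W F - s := by
      rw [starFun_of_le _ _ hs, starFun_of_le _ _ le_rfl]
      exact W.lipschitz s _ hs
    have h3 := norm_sub_le_norm_sub_add_norm_sub (starFun W F t)
      (starFun W F (W.len - cancel W F)) (starFun W F s)
    linarith

/-- Reduced concatenation. -/
noncomputable def star : ReducedPath V where
  toFun := starFun W F
  len := W.len + F.len - 2 * cancel W F
  len_nonneg := by linarith [cancel_le_left W F, cancel_le_right W F]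
  lipschitz := starFun_lipschitz W F
  of_nonpos t ht := by
    rw [starFun_of_le _ _ (by linarith [cancel_le_left W F]), W.of_nonpos t ht]
  of_len_le t ht := by
    have := cancel_le_right W F
    rw [starFun_of_ge _ _ (by linarith), starFun_of_ge _ _ (by linarith),
      F.of_len_le (_ + _) (by linarith)]
    congr 2; ring
  reduced t h0 h1 ε hε := by
    rcases lt_trichotomy t (W.len - cancel W F) with h | h | h
    · obtain ⟨s, hs0, hs1, hs⟩ := W.reduced t h0 (by linarith [cancel_nonneg W F])
        (min ε (W.len - cancel W F - t)) (lt_min hε (by linarith))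
      have := hs1.trans_le (min_le_right _ _)
      refine ⟨s, hs0, hs1.trans_le (min_le_left _ _), ?_⟩
      rwa [starFun_of_le _ _ (by linarith), starFun_of_le _ _ (by linarith)]
    -- At the junction, backtracking would contradict maximality of the cancellation.
    · obtain ⟨u, hu0, hu1, hu⟩ := exists_ne_of_agree_lt W.inv F
        (by rw [inv_len]; change cancel W F < _; linarith)
        (by change cancel W F < _; linarith) hε
      change cancel W F < u at hu0
      change u < cancel W F + ε at hu1
      refine ⟨u - cancel W F, by linarith, by linarith, fun h' => hu ?_⟩
      rw [starFun_of_ge _ _ (by linarith), starFun_of_le _ _ (by linarith), h] at h'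
      rw [inv_apply, sub_eq_iff_eq_add', ← show W.len - cancel W F - (u - cancel W F) = W.len - u
        by ring, ← h']
      congr 2; ring
    · obtain ⟨s, hs0, hs1, hs⟩ := F.reduced (t - W.len + 2 * cancel W F)
        (by linarith [cancel_nonneg W F]) (by linarith)
        (min ε (t - (W.len - cancel W F))) (lt_min hε (by linarith))
      have := hs1.trans_le (min_le_right _ _)
      refine ⟨s, hs0, hs1.trans_le (min_le_left _ _), fun h' => hs ?_⟩
      rw [starFun_of_ge _ _ (by linarith), starFun_of_ge _ _ (by linarith)] at h'
      have h' := add_left_cancel h'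
      convert h' using 2 <;> ring

theorem star_len : (W.star F).len = W.len + F.len - 2 * cancel W F := rfl

theorem star_of_le {t : ℝ} (ht : t ≤ W.len - cancel W F) : W.star F t = W t :=
  starFun_of_le W F ht

theorem star_of_ge {t : ℝ} (ht : W.len - cancel W F ≤ t) :
    W.star F t = W.endpoint + F (t - W.len + 2 * cancel W F) :=
  starFun_of_ge W F ht

theorem endpoint_star : (W.star F).endpoint = W.endpoint + F.endpoint := by
  have := cancel_le_right W F
  unfold endpoint
  rw [star_of_ge _ _ (by rw [star_len]; linarith), star_len]
  unfold endpoint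
  congr 2; ring

theorem star_zero : W.star 0 = W := by
  have h : cancel W 0 = 0 := le_antisymm (cancel_le_right W 0) (cancel_nonneg W 0)
  refine ext_of_le (by rw [star_len, h, zero_len]; ring) fun t _ ht => ?_
  rw [star_len, h, zero_len] at ht
  rw [star_of_le]
  rw [h]; linarith

/-- If `W` and `W.star F` agreed just past the junction, `F` would backtrack at time `cancel W F`.
-/
theorem agree_star : agree W (W.star F) = W.len - cancel W F := by
  have c0 := cancel_nonneg W F
  have c1 := cancel_le_right W F
  have c2 := cancel_le_left W F
  refine agree_eq (by linarith) (by rw [star_len]; linarith)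
    (fun u _ hu => (star_of_le _ _ hu.le).symm) fun h h' ε hε => ?_
  rw [star_len] at h'
  obtain ⟨s, hs0, hs1, hs⟩ := F.reduced (cancel W F) (by linarith) (by linarith)
    (min ε (cancel W F)) (lt_min hε (by linarith))
  have := hs1.trans_le (min_le_right _ _)
  have := hs1.trans_le (min_le_left _ _)
  refine ⟨W.len - cancel W F + s, by linarith, by linarith, fun h => hs ?_⟩
  rw [star_of_ge _ _ (by linarith),
    show W.len - cancel W F + s = W.len - (cancel W F - s) by ring,
    apply_sub_eq W F (by linarith)] at h
  rw [add_left_cancel h]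
  congr 1; ring

theorem cancel_inv_star : cancel W.inv (W.star F) = W.len - cancel W F := by
  unfold cancel
  rw [inv_inv, agree_star]; rfl

/-- What survives of `W` in `W.star F` is exactly what `W.inv` cancels. -/
theorem inv_star_star : W.inv.star (W.star F) = F := by
  refine ext_of_le ?_ fun t h0 ht => ?_
  · rw [star_len, star_len, cancel_inv_star, inv_len]; ring
  rcases le_total t (cancel W F) with h | h
  · rw [star_of_le, inv_apply, apply_sub_eq W F h]
    · abel
    · rw [cancel_inv_star, inv_len]; linarith
  · rw [star_of_ge, endpoint_inv, cancel_inv_star, inv_len, star_of_ge]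
    · rw [neg_add_cancel_left]; congr 1; ring
    · linarith
    · rw [cancel_inv_star, inv_len]; linarith

theorem dist_star_take_le {r : ℝ} (h0 : 0 ≤ r) (h1 : r ≤ F.len) :
    dist (W.star F) (W.star (F.take r h0 h1)) ≤ F.len - r := by
  have c0 := cancel_nonneg W F
  have c1 := cancel_le_right W F
  have c2 := cancel_le_left W F
  have hc : cancel W (F.take r h0 h1) = min r (cancel W F) := by
    refine le_antisymm (le_min (cancel_le_right _ _) (le_agree (cancel_le_left _ _)
      ((cancel_le_right _ _).trans h1) fun u _ hu => ?_)) (le_agree ?_ (min_le_left _ _) ?_)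
    · rw [eq_of_le_agree (F := W.inv) (G := F.take r h0 h1) hu.le, take_apply]
      exact hu.le.trans (cancel_le_right W (F.take r h0 h1))
    · exact (min_le_right _ _).trans c2
    · intro u _ hu
      rw [take_apply _ _ _ (hu.le.trans (min_le_left _ _))]
      exact eq_of_le_agree (hu.le.trans (min_le_right _ _))
  rw [dist_eq, star_len, star_len, hc, take_len]
  rcases le_total r (cancel W F) with h | h
  · rw [min_eq_left h] at hc ⊢
    have : W.len - cancel W F ≤ agree (W.star F) (W.star (F.take r h0 h1)) := by
      refine le_agree (by rw [star_len]; linarith) (by rw [star_len, hc, take_len]; linarith)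
        fun u _ hu => ?_
      rw [star_of_le _ _ hu.le, star_of_le]
      rw [hc]; linarith
    linarith
  · rw [min_eq_right h] at hc ⊢
    have : W.len + r - 2 * cancel W F ≤ agree (W.star F) (W.star (F.take r h0 h1)) := by
      refine le_agree (by rw [star_len]; linarith) (by rw [star_len, hc, take_len])
        fun u _ hu => ?_
      rcases le_total u (W.len - cancel W F) with h' | h'
      · rw [star_of_le _ _ h', star_of_le]
        rwa [hc]
      · rw [star_of_ge _ _ h', star_of_ge, hc, take_apply]
        · linarith
        · rwa [hc]
    linarith

/-- Pass through the common initial subpath: truncating `F` and `G` to it costs exactly `dist F G`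
in total. -/
theorem dist_star_le (G : ReducedPath V) : dist (W.star F) (W.star G) ≤ dist F G := by
  have h1 := dist_star_take_le W F (agree_nonneg F G) (agree_le_left F G)
  have h2 := dist_star_take_le W G (agree_nonneg F G) (agree_le_right F G)
  have h3 : F.take (agree F G) (agree_nonneg F G) (agree_le_left F G) =
      G.take (agree F G) (agree_nonneg F G) (agree_le_right F G) :=
    ext_of_le rfl fun t _ ht => by
      rw [take_len] at ht
      rw [take_apply _ _ _ ht, take_apply _ _ _ ht, eq_of_le_agree ht]
  rw [h3] at h1
  have := dist_triangle_right (W.star F) (W.star G)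
    (W.star (G.take (agree F G) (agree_nonneg F G) (agree_le_right F G)))
  rw [dist_eq F G]
  linarith

end cancel

/-- Left translation by `W`. -/
noncomputable def translate (W : ReducedPath V) : ReducedPath V ≃ᵢ ReducedPath V where
  toFun := W.star
  invFun := W.inv.star
  left_inv := inv_star_star W
  right_inv F := by
    have := inv_star_star W.inv F
    rwa [inv_inv] at this
  isometry_toFun := Isometry.of_dist_eq fun F G => by
    refine le_antisymm (dist_star_le W F G) ?_
    have := dist_star_le W.inv (W.star F) (W.star G)
    rwa [inv_star_star, inv_star_star] at this

theorem translate_zero (W : ReducedPath V) : W.translate 0 = W := star_zero W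

theorem endpoint_translate (W F : ReducedPath V) :
    (W.translate F).endpoint = W.endpoint + F.endpoint := endpoint_star W F

/-- The image of a path under a linear isometry. -/
def map [NormedSpace ℝ V] (U : V ≃ₗᵢ[ℝ] V) (F : ReducedPath V) : ReducedPath V where
  toFun t := U (F t)
  len := F.len
  len_nonneg := F.len_nonneg
  lipschitz s t hst := by
    rw [← U.map_sub, U.norm_map]; exact F.lipschitz s t hst
  of_nonpos t ht := by rw [F.of_nonpos t ht, U.map_zero]
  of_len_le t ht := by rw [F.of_len_le t ht]
  reduced t h0 h1 ε hε := by
    obtain ⟨s, hs0, hs1, hs⟩ := F.reduced t h0 h1 ε hε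
    exact ⟨s, hs0, hs1, fun h => hs (U.injective h)⟩

/-- Linear isometries act on reduced paths by isometries. -/
noncomputable def mapIsometry [NormedSpace ℝ V] (U : V ≃ₗᵢ[ℝ] V) :
    ReducedPath V ≃ᵢ ReducedPath V where
  toFun := map U
  invFun := map U.symm
  left_inv F := ReducedPath.ext (funext fun t => U.symm_apply_apply _) rfl
  right_inv F := ReducedPath.ext (funext fun t => U.apply_symm_apply _) rfl
  isometry_toFun := Isometry.of_dist_eq fun F G => by
    have : agree (map U F) (map U G) = agree F G := by
      refine le_antisymm (le_agree (agree_le_left (map U F) _) (agree_le_right _ (map U G))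
        fun u _ hu => U.injective (eq_of_le_agree hu.le)) ?_
      exact le_agree (agree_le_left F G) (agree_le_right F G) fun u _ hu =>
        congrArg U (eq_of_le_agree hu.le)
    rw [dist_eq, this]; rfl

/-! ### Isometries covering affine isometries -/

variable [NormedSpace ℝ V]

/-- `g` transforms endpoints by the affine isometry `v ↦ U v + d`. -/
def Covers (g : ReducedPath V ≃ᵢ ReducedPath V) (U : V ≃ₗᵢ[ℝ] V) (d : V) : Prop :=
  ∀ F, (g F).endpoint = U F.endpoint + d

theorem exists_covers (U : V ≃ₗᵢ[ℝ] V) (x y : ReducedPath V) :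
    ∃ g d, Covers g U d ∧ g x = y := by
  refine ⟨y.translate * mapIsometry U * x.translate⁻¹, y.endpoint - U x.endpoint, fun F => ?_, ?_⟩
  · have h : x.endpoint + (x.translate⁻¹ F).endpoint = F.endpoint := by
      rw [← endpoint_translate]
      exact congrArg endpoint (x.translate.apply_symm_apply F)
    change (y.translate (map U (x.translate⁻¹ F))).endpoint = _
    rw [endpoint_translate, ← h, U.map_add]
    change _ + U (x.translate⁻¹ F).endpoint = _
    abel
  · have h : x.translate⁻¹ x = 0 := by
      conv_lhs => rw [← translate_zero x]
      rw [translate_zero]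
      refine x.translate.injective ?_
      rw [translate_zero]
      exact x.translate.apply_symm_apply x
    change y.translate (map U (x.translate⁻¹ x)) = y
    rw [h]
    have : map U (0 : ReducedPath V) = 0 := ReducedPath.ext (funext fun _ => U.map_zero) rfl
    rw [this, translate_zero]

/-- Rigidity: an isometry fixing `0` carries initial subpaths to initial subpaths of the same
length, and their endpoints are the values of the path. -/
theorem Covers.eq_map {g : ReducedPath V ≃ᵢ ReducedPath V} {U : V ≃ₗᵢ[ℝ] V} {d : V}
    (hg : Covers g U d) (h0 : g 0 = 0) : g = mapIsometry U := by
  have hd : d = 0 := by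
    have := hg 0
    rw [h0, endpoint_zero, U.map_zero, zero_add] at this
    exact this.symm
  subst hd
  have hlen : ∀ F, (g F).len = F.len := fun F => by
    rw [← dist_zero (g F), ← dist_zero F, ← g.dist_eq 0 F, h0]
  refine IsometryEquiv.ext fun F => ext_of_le (hlen F) fun t ht0 ht => ?_
  have htF : t ≤ F.len := by rwa [← hlen F]
  have h1 : g (F.take t ht0 htF) = (g F).take t ht0 ht := by
    refine isTreeLike.eq_of_between (a := 0) (b := g F) ?_ ?_ ?_
    · rw [IsBetween, dist_zero, dist_zero, hlen, g.dist_eq, dist_comm, dist_take, hlen, take_len]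
      ring
    · rw [IsBetween, dist_zero, dist_zero, dist_comm, dist_take, take_len]
      ring
    · rw [dist_zero, dist_zero, hlen, take_len, take_len]
  have h2 := hg (F.take t ht0 htF)
  rw [h1, take_endpoint, take_endpoint, add_zero] at h2
  exact h2

theorem Covers.mul {g h : ReducedPath V ≃ᵢ ReducedPath V} {U U' : V ≃ₗᵢ[ℝ] V} {d d' : V}
    (hg : Covers g U d) (hh : Covers h U' d') : Covers (g * h) (U * U') (U d' + d) := fun F => by
  change (g (h F)).endpoint = U (U' F.endpoint) + _
  rw [hg, hh, U.map_add]; abel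

theorem Covers.inv {g : ReducedPath V ≃ᵢ ReducedPath V} {U : V ≃ₗᵢ[ℝ] V} {d : V}
    (hg : Covers g U d) : Covers g⁻¹ U⁻¹ (-(U⁻¹ d)) := fun F => by
  have h := hg (g⁻¹ F)
  rw [show g (g⁻¹ F) = F from g.apply_symm_apply F] at h
  rw [h]
  change _ = U.symm (U _ + d) + -(U.symm d)
  rw [map_add, U.symm_apply_apply]; abel

theorem covers_one : Covers (1 : ReducedPath V ≃ᵢ ReducedPath V) 1 0 := fun _ => (add_zero _).symm

/-- Conjugating the fixed point to the base point. -/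
theorem Covers.conj {g : ReducedPath V ≃ᵢ ReducedPath V} {U : V ≃ₗᵢ[ℝ] V} {d : V}
    (hg : Covers g U d) {x : ReducedPath V} (hx : g x = x) :
    x.translate⁻¹ * g * x.translate = mapIsometry U := by
  have ht : Covers x.translate 1 x.endpoint := fun F => by
    rw [endpoint_translate, add_comm]; rfl
  have := (ht.inv.mul hg).mul ht
  rw [inv_one, one_mul, mul_one] at this
  refine this.eq_map ?_
  change x.translate⁻¹ (g (x.translate 0)) = 0
  rw [translate_zero, hx]
  exact (x.translate.symm_apply_eq).2 (translate_zero x).symm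

theorem Covers.eq_one {g : ReducedPath V ≃ᵢ ReducedPath V} {d : V}
    (hg : Covers g 1 d) {x : ReducedPath V} (hx : g x = x) : g = 1 := by
  have h := hg.conj hx
  have h1 : mapIsometry (1 : V ≃ₗᵢ[ℝ] V) = 1 := rfl
  rw [h1] at h
  calc g = x.translate * (x.translate⁻¹ * g * x.translate) * x.translate⁻¹ := by group
    _ = 1 := by rw [h]; group

theorem Covers.ne_self {g : ReducedPath V ≃ᵢ ReducedPath V} {d : V} (hg : Covers g 1 d)
    (h : g ≠ 1) (x : ReducedPath V) : g x ≠ x :=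
  fun hx => h (hg.eq_one hx)

/-- A twisted isometry with a fixed point and bounded displacement is untwisted. -/
theorem Covers.eq_one_of_bounded {g : ReducedPath V ≃ᵢ ReducedPath V} {U : V ≃ₗᵢ[ℝ] V} {d : V}
    (hg : Covers g U d) {x : ReducedPath V} (hx : g x = x) {M : ℝ}
    (hM : ∀ y, dist y (g y) ≤ M) : U = 1 := by
  have h := hg.conj hx
  have hM' : ∀ y, dist y (map U y) ≤ M := fun y => by
    have e : map U y = x.translate⁻¹ (g (x.translate y)) := (DFunLike.congr_fun h y).symm
    rw [e, ← x.translate.dist_eq]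
    rw [show x.translate (x.translate⁻¹ (g (x.translate y))) = _ from
      x.translate.apply_symm_apply _]
    exact hM _
  by_contra hU
  obtain ⟨v, hv⟩ : ∃ v, U v ≠ v := by
    by_contra! h
    exact hU (LinearIsometryEquiv.ext h)
  have hv0 : v ≠ 0 := by rintro rfl; exact hv U.map_zero
  have hnv : ‖v‖ ≠ 0 := norm_ne_zero_iff.2 hv0
  -- The straight path of length `M + 1` with velocity `w` and its image diverge at once, so they
  -- are `2 * (M + 1)` apart.
  set w := ‖v‖⁻¹ • v with hw
  have hw0 : w ≠ 0 := smul_ne_zero (inv_ne_zero hnv) hv0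
  have hw1 : ‖w‖ ≤ 1 := by
    rw [hw, norm_smul, norm_inv, norm_norm, inv_mul_cancel₀ hnv]
  have hUw : w ≠ U w := by
    rw [hw, U.map_smul]
    exact fun h => hv (smul_right_injective V (inv_ne_zero hnv) h).symm
  have hM0 : 0 ≤ M := dist_nonneg.trans (hM x)
  have hl : 0 ≤ M + 1 := by linarith
  have h2 : map U (line w hw0 hw1 (M + 1) hl) =
      line (U w) (by simpa using hw0) (by rwa [U.norm_map]) (M + 1) hl := by
    refine ReducedPath.ext (funext fun t => ?_) rfl
    exact U.map_smul _ _
  have h3 := hM' (line w hw0 hw1 (M + 1) hl)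
  rw [h2, dist_line_of_ne _ _ _ _ _ _ hUw] at h3
  linarith

end ReducedPath

/-! ### The universal tree and the twisted group -/

/-- The complete `ℝ`-tree of valence continuum used below. -/
abbrev PlaneTree : Type := ReducedPath (ℂ × ℂ)

namespace PlaneTree

open ReducedPath

/-- A faithful isometric representation of `ℝ`. -/
noncomputable def twist (a : ℝ) : (ℂ × ℂ) ≃ₗᵢ[ℝ] (ℂ × ℂ) where
  toLinearEquiv := LinearEquiv.prodCongr (rotation (Circle.exp a)).toLinearEquiv
    (rotation (Circle.exp (√2 * a))).toLinearEquiv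
  norm_map' x := by
    change max ‖rotation (Circle.exp a) x.1‖ ‖rotation (Circle.exp (√2 * a)) x.2‖ = max _ _
    rw [LinearIsometryEquiv.norm_map, LinearIsometryEquiv.norm_map]

theorem twist_apply (a : ℝ) (x : ℂ × ℂ) :
    twist a x = (Circle.exp a * x.1, Circle.exp (√2 * a) * x.2) := rfl

theorem twist_add (a b : ℝ) : twist (a + b) = twist a * twist b := by
  ext x
  · change (twist (a + b) x).1 = (twist a (twist b x)).1
    simp only [twist_apply, Circle.exp_add, Circle.coe_mul, mul_assoc]
  · change (twist (a + b) x).2 = (twist a (twist b x)).2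
    simp only [twist_apply, mul_add, Circle.exp_add, Circle.coe_mul, mul_assoc]

theorem twist_zero : twist 0 = 1 := by
  ext x
  · change (twist 0 x).1 = x.1
    simp [twist_apply]
  · change (twist 0 x).2 = x.2
    simp [twist_apply]

theorem twist_neg (a : ℝ) : twist (-a) = (twist a)⁻¹ := by
  rw [eq_inv_iff_mul_eq_one, ← twist_add, neg_add_cancel, twist_zero]

/-- Both `a` and `√2 * a` would be integer multiples of `2π`; irrationality of `√2` leaves only `0`.
-/
theorem eq_zero_of_twist_eq_one {a : ℝ} (h : twist a = 1) : a = 0 := by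
  have h1 : twist a (1, 1) = (1, 1) := by rw [h]; rfl
  rw [twist_apply, Prod.mk.injEq, mul_one, mul_one] at h1
  obtain ⟨m, hm⟩ := Circle.exp_eq_one.1 (Circle.ext h1.1)
  obtain ⟨n, hn⟩ := Circle.exp_eq_one.1 (Circle.ext h1.2)
  rw [hm, ← mul_assoc] at hn
  have hn := mul_right_cancel₀ Real.two_pi_pos.ne' hn
  rcases eq_or_ne m 0 with rfl | hm0
  · simpa using hm
  · exact absurd hn ((irrational_sqrt_two.mul_intCast hm0).ne_int n)

/-- The isometries preserving endpoints up to translation. -/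
def translationGroup : Subgroup (PlaneTree ≃ᵢ PlaneTree) where
  carrier := {g | ∃ d, Covers g 1 d}
  one_mem' := ⟨0, covers_one⟩
  mul_mem' := by
    rintro g h ⟨d, hg⟩ ⟨d', hh⟩
    exact ⟨_, hg.mul hh⟩
  inv_mem' := by
    rintro g ⟨d, hg⟩
    exact ⟨_, hg.inv⟩

/-- The elements of `translationGroup` whose translation part has vanishing height. -/
def levelGroup : Subgroup (PlaneTree ≃ᵢ PlaneTree) where
  carrier := {g | ∃ d : ℂ × ℂ, Covers g 1 d ∧ d.1.re = 0}
  one_mem' := ⟨0, covers_one, rfl⟩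
  mul_mem' := by
    rintro g h ⟨d, hg, hd⟩ ⟨d', hh, hd'⟩
    refine ⟨_, hg.mul hh, ?_⟩
    change (d' + d).1.re = 0
    simp [hd, hd']
  inv_mem' := by
    rintro g ⟨d, hg, hd⟩
    refine ⟨_, hg.inv, ?_⟩
    change (-d).1.re = 0
    simp [hd]

/-- Pairs of isometries, where the translation part of the first twists the second. -/
def twistedGroup : Subgroup ((PlaneTree ≃ᵢ PlaneTree) × (PlaneTree ≃ᵢ PlaneTree)) where
  carrier := {g | ∃ c d : ℂ × ℂ, Covers g.1 1 c ∧ Covers g.2 (twist c.1.re) d}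
  one_mem' := ⟨0, 0, covers_one, by
    change Covers 1 (twist 0) 0
    rw [twist_zero]; exact covers_one⟩
  mul_mem' := by
    rintro g h ⟨c, d, hg1, hg2⟩ ⟨c', d', hh1, hh2⟩
    refine ⟨_, twist c.1.re d' + d, hg1.mul hh1, ?_⟩
    have := hg2.mul hh2
    rw [← twist_add, add_comm c.1.re] at this
    exact this
  inv_mem' := by
    rintro g ⟨c, d, hg1, hg2⟩
    have := hg2.inv
    rw [← twist_neg] at this
    refine ⟨_, -(twist (-c.1.re) d), hg1.inv, ?_⟩
    exact this

theorem exists_translation (x y : PlaneTree) :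
    ∃ g, Covers g 1 (y.endpoint - x.endpoint) ∧ g x = y := by
  obtain ⟨g, d, hg, hxy⟩ := exists_covers 1 x y
  have : d = y.endpoint - x.endpoint := by
    have := hg x
    rw [hxy] at this
    rw [this]
    change d = x.endpoint + d - x.endpoint
    abel
  exact ⟨g, this ▸ hg, hxy⟩

/-- The path of velocity `(r, 0)`. -/
noncomputable def ray (r : Set.Ioc (0 : ℝ) 1) (l : ℝ) (hl : 0 ≤ l) : PlaneTree :=
  line ((r : ℂ), 0) (fun h => r.2.1.ne' (by simpa using h))
    (by
      change max ‖((r : ℝ) : ℂ)‖ ‖(0 : ℂ)‖ ≤ 1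
      rw [norm_zero, Complex.norm_real, Real.norm_eq_abs, abs_of_pos r.2.1]
      exact max_le r.2.2 zero_le_one) l hl

theorem dist_zero_ray (r : Set.Ioc (0 : ℝ) 1) {l : ℝ} (hl : 0 ≤ l) : dist 0 (ray r l hl) = l :=
  ReducedPath.dist_zero _

theorem endpoint_ray_re (r : Set.Ioc (0 : ℝ) 1) {l : ℝ} (hl : 0 ≤ l) :
    (ray r l hl).endpoint.1.re = l * r := by
  unfold ray
  rw [endpoint_line]
  simp

theorem dist_ray {r s : Set.Ioc (0 : ℝ) 1} (h : r ≠ s) {l : ℝ} (hl : 0 ≤ l) :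
    dist (ray r l hl) (ray s l hl) = l + l :=
  dist_line_of_ne _ _ _ _ _ _ fun h' => h (Subtype.ext (by simpa using h'))

/-- The whole tree has at most continuum many points, while translated rays of distinct speeds leave
`x` in distinct directions. -/
theorem hasValence : HasValence PlaneTree Cardinal.continuum := by
  intro x
  refine le_antisymm ?_ ?_
  · refine (Cardinal.mk_le_of_surjective (Quot.mk_surjective (r := _))).trans <|
      (Cardinal.mk_subtype_le _).trans (mk_le_continuum _ ?_)
    simp
  · rw [← Cardinal.mk_Ioc_real (zero_lt_one' ℝ)]
    have hd : ∀ r, dist x (x.translate (ray r 1 zero_le_one)) = 1 := fun r => by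
      nth_rw 1 [← ReducedPath.translate_zero x]
      rw [x.translate.dist_eq, dist_zero_ray]
    refine isTreeLike.le_mk_direction (fun r => x.translate (ray r 1 zero_le_one)) ?_ ?_
    · intro r h
      have := hd r
      rw [h, dist_self] at this
      exact zero_ne_one this
    · intro r s hrs
      rw [hd, hd, x.translate.dist_eq, dist_ray hrs]

/-- A non-trivial translation has unbounded displacement. -/
theorem unbounded_displacement {p : PlaneTree ≃ᵢ PlaneTree} (hp : p 0 ≠ 0) (M : ℝ) :
    ∃ y, M < dist y (p y) := by
  have ha : 0 < dist 0 (p 0) := dist_pos.2 hp.symm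
  set n := |M| + 1 with hn
  have hn0 : 0 ≤ n := by positivity
  have hMn : M < n := by linarith [le_abs_self M]
  have hT : IsTreeLike PlaneTree := isTreeLike
  have d0 : ∀ r, dist 0 (ray r n hn0) = n := fun r => dist_zero_ray r hn0
  have d1 : ∀ r, dist (p 0) (p (ray r n hn0)) = n := fun r => by rw [p.dist_eq, d0]
  -- If the ray avoids the direction from `0` to `p 0`, and its image avoids the direction from `p
  -- 0` to `0`, the displacement of its tip is at least `2 * n + dist 0 (p 0)`.
  have good : ∀ r, ¬ dist (ray r n hn0) (p 0) < dist 0 (ray r n hn0) + dist 0 (p 0) →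
      ¬ dist (p (ray r n hn0)) 0 < dist (p 0) (p (ray r n hn0)) + dist (p 0) 0 →
      ∃ y, M < dist y (p y) := by
    intro r h1 h2
    refine ⟨ray r n hn0, ?_⟩
    have h4 := hT.four_point (ray r n hn0) (p 0) (p (ray r n hn0)) 0
    rw [dist_comm (ray r n hn0) 0, d1, d0] at h4
    rw [d0] at h1
    rw [d1, dist_comm (p 0) 0] at h2
    rcases le_max_iff.1 h4 with h | h
    · rw [dist_comm (p 0) 0] at h; linarith
    · linarith
  have bad1 : ∀ r s, r ≠ s → dist (ray r n hn0) (p 0) < dist 0 (ray r n hn0) + dist 0 (p 0) →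
      ¬ dist (ray s n hn0) (p 0) < dist 0 (ray s n hn0) + dist 0 (p 0) := by
    intro r s hrs h1 h2
    rw [dist_comm, add_comm] at h2
    have := hT.gromov_pos_trans h1 h2
    rw [dist_ray hrs, d0, d0] at this
    linarith
  have bad2 : ∀ r s, r ≠ s →
      dist (p (ray r n hn0)) 0 < dist (p 0) (p (ray r n hn0)) + dist (p 0) 0 →
      ¬ dist (p (ray s n hn0)) 0 < dist (p 0) (p (ray s n hn0)) + dist (p 0) 0 := by
    intro r s hrs h1 h2
    rw [dist_comm, add_comm] at h2
    have := hT.gromov_pos_trans h1 h2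
    rw [p.dist_eq, dist_ray hrs, d1, d1] at this
    linarith
  -- Each of the two bad directions excludes at most one ray, so three rays suffice.
  obtain ⟨r₁, r₂, r₃, h12, h13, h23⟩ :
      ∃ r₁ r₂ r₃ : Set.Ioc (0 : ℝ) 1, r₁ ≠ r₂ ∧ r₁ ≠ r₃ ∧ r₂ ≠ r₃ := by
    refine ⟨⟨1, by norm_num⟩, ⟨1 / 2, by norm_num⟩, ⟨1 / 3, by norm_num⟩, ?_⟩
    simp only [ne_eq, Subtype.mk.injEq]
    norm_num
  by_contra hcon
  have bad : ∀ r, dist (ray r n hn0) (p 0) < dist 0 (ray r n hn0) + dist 0 (p 0) ∨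
      dist (p (ray r n hn0)) 0 < dist (p 0) (p (ray r n hn0)) + dist (p 0) 0 := fun r => by
    by_contra h
    exact hcon (good r (fun h' => h (Or.inl h')) fun h' => h (Or.inr h'))
  exact match bad r₁, bad r₂, bad r₃ with
    | .inl x, .inl y, _ => bad1 _ _ h12 x y
    | .inr x, .inr y, _ => bad2 _ _ h12 x y
    | .inl x, _, .inl z => bad1 _ _ h13 x z
    | .inr x, _, .inr z => bad2 _ _ h13 x z
    | _, .inl y, .inl z => bad1 _ _ h23 y z
    | _, .inr y, .inr z => bad2 _ _ h23 y z

/-! ### Cobounded irreducibility -/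

theorem twistedGroup_eq_one {g : (PlaneTree ≃ᵢ PlaneTree) × (PlaneTree ≃ᵢ PlaneTree)}
    (hg : g ∈ twistedGroup) {x y : PlaneTree} (hx : g.1 x = x) (hy : g.2 y = y) : g = 1 := by
  obtain ⟨c, d, h1, h2⟩ := hg
  have hc : c = 0 := by
    have := h1 x
    rw [hx] at this
    exact left_eq_add.1 this
  subst hc
  change Covers _ (twist 0) _ at h2
  rw [twist_zero] at h2
  exact Prod.ext (h1.eq_one hx) (h2.eq_one hy)

section Cobounded

variable {A B : Type*} [Group A] [Group B]
  {ρ : A × B →* (PlaneTree ≃ᵢ PlaneTree) × (PlaneTree ≃ᵢ PlaneTree)}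

theorem commute_fst (a : A) (b : B) : Commute (ρ (a, 1)).1 (ρ (1, b)).1 := by
  have h : Commute (ρ (a, 1)) (ρ (1, b)) := by
    change _ * _ = _ * _
    rw [← map_mul, ← map_mul]; simp
  exact h.map (MonoidHom.fst _ _)

theorem commute_snd (a : A) (b : B) : Commute (ρ (a, 1)).2 (ρ (1, b)).2 := by
  have h : Commute (ρ (a, 1)) (ρ (1, b)) := by
    change _ * _ = _ * _
    rw [← map_mul, ← map_mul]; simp
  exact h.map (MonoidHom.snd _ _)

theorem map_eq_mul (h : A × B) : ρ h = ρ (h.1, 1) * ρ (1, h.2) := by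
  rw [← map_mul]; simp

/-- Only `B` moves the first tree, yet coboundedness on the second tree forces `B` to have height
zero. -/
theorem not_cobounded_of_fst_trivial [Nontrivial A] (hρ : Function.Injective ρ)
    (hmem : ∀ h, ρ h ∈ twistedGroup) (htriv : ∀ a, (ρ (a, 1)).1 = 1) {R : ℝ}
    (hR : ∀ x y, ∃ h, dist x ((ρ h).1 0) ≤ R ∧ dist y ((ρ h).2 0) ≤ R) : False := by
  obtain ⟨a₀, ha₀⟩ := exists_ne (1 : A)
  have hT : IsTreeLike PlaneTree := isTreeLike
  have hp : ∀ y, (ρ (a₀, 1)).2 y ≠ y := fun y hy => by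
    have h := twistedGroup_eq_one (x := 0) (hmem (a₀, 1)) (by rw [htriv]; rfl) hy
    rw [← map_one ρ] at h
    exact ha₀ (congrArg Prod.fst (hρ h))
  have hfix : ∀ b, ∃ f, (ρ (1, b)).2 f = f := by
    intro b
    by_contra! hq
    obtain ⟨M, hM⟩ := hT.displacement_bounded
      (P := Set.range fun a => (ρ (a, (1 : B))).2) (Q := Set.range fun b => (ρ ((1 : A), b)).2)
      (by rintro _ ⟨a, rfl⟩ _ ⟨b, rfl⟩; exact commute_snd a b) ⟨a₀, rfl⟩ ⟨b, rfl⟩ hp hq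
      (o := 0) (R := R) fun y => by
        obtain ⟨h, -, hy⟩ := hR 0 y
        rw [map_eq_mul] at hy
        exact ⟨_, ⟨h.1, rfl⟩, _, ⟨h.2, rfl⟩, hy⟩
    obtain ⟨y, hy⟩ := unbounded_displacement (hp 0) M
    exact hy.not_ge (hM y)
  obtain ⟨z, hz⟩ := hT.axisSet_nonempty hp 0
  have hz' : ∀ b, (ρ (1, b)).2 z = z := fun b => by
    obtain ⟨f, hf⟩ := hfix b
    exact hT.fixes_axisSet hp (commute_snd a₀ b) hf hz
  have hlevel : ∀ b, ((ρ (1, b)).1 0).endpoint.1.re = 0 := by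
    intro b
    obtain ⟨c, d, h1, h2⟩ := hmem (1, b)
    -- `B` fixes `z` and commutes with `A`, so it fixes `A`'s orbit of `z`. Since `B` fixes `z`,
    -- that orbit is already coarsely dense, which bounds the displacement of `b`.
    have hU : twist c.1.re = 1 := by
      refine h2.eq_one_of_bounded (hz' b) (M := 2 * (R + dist 0 z)) fun y => ?_
      obtain ⟨h, -, hy⟩ := hR 0 y
      rw [map_eq_mul] at hy
      change dist y ((ρ (h.1, 1)).2 ((ρ (1, h.2)).2 0)) ≤ R at hy
      set p := (ρ (h.1, 1)).2 with hpdef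
      have hpz : (ρ (1, b)).2 (p z) = p z := by
        have := DFunLike.congr_fun (commute_snd (ρ := ρ) h.1 b).eq z
        change p ((ρ (1, b)).2 z) = (ρ (1, b)).2 (p z) at this
        rw [← this, hz']
      have e1 : dist (p ((ρ (1, h.2)).2 0)) (p z) = dist 0 z := by
        rw [p.dist_eq]
        conv_lhs => rw [← hz' h.2]
        rw [IsometryEquiv.dist_eq]
      have e2 := dist_triangle y (p ((ρ (1, h.2)).2 0)) (p z)
      have e3 := dist_triangle y (p z) ((ρ (1, b)).2 y)
      have e4 : dist (p z) ((ρ (1, b)).2 y) = dist y (p z) := by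
        conv_lhs => rw [← hpz]
        rw [IsometryEquiv.dist_eq, dist_comm]
      linarith
    rw [h1 0]
    change (0 + c).1.re = 0
    rw [zero_add]
    exact eq_zero_of_twist_eq_one hU
  have hR0 : 0 ≤ R := by
    obtain ⟨h, hx, -⟩ := hR 0 0
    exact dist_nonneg.trans hx
  -- This point has height `R + 1`, height is `1`-Lipschitz, and the orbit of `0` has height `0`.
  obtain ⟨h, hx, -⟩ := hR (ray ⟨1, by norm_num, le_rfl⟩ (R + 1) (by linarith)) 0
  rw [map_eq_mul] at hx
  change dist _ ((ρ (h.1, 1)).1 ((ρ (1, h.2)).1 0)) ≤ R at hx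
  rw [htriv] at hx
  change dist _ ((ρ (1, h.2)).1 0) ≤ R at hx
  have e1 := (norm_endpoint_sub_le _ _).trans hx
  have e2 := (norm_fst_le _).trans e1
  have e3 := (Complex.abs_re_le_norm _).trans e2
  rw [Prod.fst_sub, Complex.sub_re, hlevel, endpoint_ray_re, sub_zero, mul_one] at e3
  linarith [le_abs_self (R + 1)]

theorem not_cobounded [Nontrivial A] [Nontrivial B] (hρ : Function.Injective ρ)
    (hmem : ∀ h, ρ h ∈ twistedGroup) {R : ℝ}
    (hR : ∀ x y, ∃ h, dist x ((ρ h).1 0) ≤ R ∧ dist y ((ρ h).2 0) ≤ R) : False := by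
  by_cases hA : ∀ a, (ρ (a, 1)).1 = 1
  · exact not_cobounded_of_fst_trivial hρ hmem hA hR
  by_cases hB : ∀ b, (ρ (1, b)).1 = 1
  · refine not_cobounded_of_fst_trivial (R := R)
      (ρ := ρ.comp (MulEquiv.prodComm (M := B) (N := A)).toMonoidHom)
      (hρ.comp (MulEquiv.prodComm (M := B) (N := A)).injective) (fun h => hmem _) hB
      fun x y => ?_
    obtain ⟨h, hx⟩ := hR x y
    exact ⟨h.swap, hx⟩
  push Not at hA hB
  obtain ⟨a, ha⟩ := hA
  obtain ⟨b, hb⟩ := hB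
  have hT : IsTreeLike PlaneTree := isTreeLike
  obtain ⟨c, d, h1, -⟩ := hmem (a, 1)
  obtain ⟨c', d', h1', -⟩ := hmem (1, b)
  have hp := h1.ne_self ha
  obtain ⟨M, hM⟩ := hT.displacement_bounded
    (P := Set.range fun a => (ρ (a, (1 : B))).1) (Q := Set.range fun b => (ρ ((1 : A), b)).1)
    (by rintro _ ⟨a, rfl⟩ _ ⟨b, rfl⟩; exact commute_fst a b) ⟨a, rfl⟩ ⟨b, rfl⟩ hp
    (h1'.ne_self hb) (o := 0) (R := R) fun y => by
      obtain ⟨h, hy, -⟩ := hR y 0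
      rw [map_eq_mul] at hy
      exact ⟨_, ⟨h.1, rfl⟩, _, ⟨h.2, rfl⟩, hy⟩
  obtain ⟨y, hy⟩ := unbounded_displacement (hp 0) M
  exact hy.not_ge (hM y)

end Cobounded

theorem dist_prod (p q : WithLp 1 (PlaneTree × PlaneTree)) :
    dist p q = dist p.fst q.fst + dist p.snd q.snd := by
  rw [WithLp.prod_dist_eq_add (by simp)]; simp

theorem not_coboundedlyReducible :
    ¬ CoboundedlyReducible twistedGroup (WithLp 1 (PlaneTree × PlaneTree)) := by
  rintro ⟨H, ⟨A, B, _, _, _, _, ⟨e⟩⟩, S, hS, hcov⟩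
  obtain ⟨R, hR⟩ := hS.subset_closedBall (WithLp.toLp 1 (0, 0))
  refine not_cobounded
    (ρ := (twistedGroup.subtype.comp H.subtype).comp e.symm.toMonoidHom) (R := R) ?_ ?_ ?_
  · exact (Subtype.val_injective.comp Subtype.val_injective).comp e.symm.injective
  · exact fun h => (e.symm h).1.2
  · intro x y
    obtain ⟨g, b, hb, hgb⟩ := hcov (WithLp.toLp 1 (x, y))
    have hbR : dist b (WithLp.toLp 1 (0, 0)) ≤ R := hR hb
    rw [dist_prod] at hbR
    refine ⟨e g, ?_⟩
    have hx : g.1.1.1 b.fst = x := congrArg (fun p => WithLp.fst p) hgb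
    have hy : g.1.1.2 b.snd = y := congrArg (fun p => WithLp.snd p) hgb
    change dist x ((e.symm (e g)).1.1.1 0) ≤ R ∧ dist y ((e.symm (e g)).1.1.2 0) ≤ R
    rw [e.symm_apply_apply, ← hx, ← hy, IsometryEquiv.dist_eq, IsometryEquiv.dist_eq]
    change dist b.fst 0 + dist b.snd 0 ≤ R at hbR
    have h1 := dist_nonneg (x := b.fst) (y := 0)
    have h2 := dist_nonneg (x := b.snd) (y := 0)
    exact ⟨by linarith, by linarith⟩

/-! ### Essential reducibility -/

theorem level_prod_le : levelGroup.prod translationGroup ≤ twistedGroup := by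
  rintro ⟨g1, g2⟩ ⟨⟨c, hc, hc0⟩, ⟨d, hd⟩⟩
  refine ⟨c, d, hc, ?_⟩
  rw [hc0, twist_zero]; exact hd

/-- Leave `y` along two straight paths whose velocities share the first component, chosen to reach
the height of `x`, and have opposite second components. Their ends lie in the orbit of `x`, on
opposite sides of `y`. -/
theorem exists_level_between (x y : PlaneTree) :
    ∃ g₁ ∈ levelGroup, ∃ g₂ ∈ levelGroup, IsBetween (g₁ x) y (g₂ x) := by
  set δ := (x.endpoint - y.endpoint).1.re with hδ
  -- Large enough that the slope `δ / l` keeps the velocity in the unit ball of the max norm, and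
  -- positive even when `δ = 0`.
  set l := |δ| + 1 with hl
  have hl0 : 0 < l := by positivity
  have hn : ∀ z : ℂ, ‖z‖ = 1 → ‖(((δ / l : ℝ) : ℂ), z)‖ ≤ 1 := fun z hz => by
    change max ‖((δ / l : ℝ) : ℂ)‖ ‖z‖ ≤ 1
    rw [hz, Complex.norm_real, Real.norm_eq_abs, abs_div, abs_of_pos hl0]
    exact max_le ((div_le_one hl0).2 (by linarith)) le_rfl
  have hv : ∀ z : ℂ, ‖z‖ = 1 → (((δ / l : ℝ) : ℂ), z) ≠ 0 := fun z hz h => by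
    rw [show z = 0 from congrArg Prod.snd h, norm_zero] at hz
    exact zero_ne_one hz
  have key : ∀ (z : ℂ) (hz : ‖z‖ = 1), ∃ g ∈ levelGroup,
      g x = y.translate (line _ (hv z hz) (hn z hz) l hl0.le) := by
    intro z hz
    obtain ⟨g, hg, hgx⟩ := exists_translation x
      (y.translate (line _ (hv z hz) (hn z hz) l hl0.le))
    refine ⟨g, ⟨_, hg, ?_⟩, hgx⟩
    rw [endpoint_translate, endpoint_line]
    simp only [Prod.fst_sub, Prod.fst_add, Prod.smul_fst, Complex.sub_re, Complex.add_re,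
      Complex.smul_re, Complex.ofReal_re, smul_eq_mul] at hδ ⊢
    rw [mul_div_cancel₀ _ hl0.ne', hδ]; ring
  obtain ⟨g₁, hg₁, h₁⟩ := key 1 (by simp)
  obtain ⟨g₂, hg₂, h₂⟩ := key (-1) (by simp)
  refine ⟨g₁, hg₁, g₂, hg₂, ?_⟩
  rw [h₁, h₂]
  nth_rw 2 [← ReducedPath.translate_zero y]
  refine IsBetween.map _ ?_
  rw [IsBetween, dist_comm, ReducedPath.dist_zero, ReducedPath.dist_zero, dist_line_of_ne]
  · rfl
  · intro h
    have := congrArg Prod.snd h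
    norm_num at this

theorem essentiallyReducible :
    EssentiallyReducible twistedGroup (WithLp 1 (PlaneTree × PlaneTree)) := by
  have hnontriv : ∀ K : Subgroup (PlaneTree ≃ᵢ PlaneTree), levelGroup ≤ K → Nontrivial K := by
    intro K hK
    set w : PlaneTree := line (0, 1) (by simp) (by
      change max ‖(0 : ℂ)‖ ‖(1 : ℂ)‖ ≤ 1
      simp) 1 zero_le_one with hw
    obtain ⟨g, hg, hg0⟩ := exists_translation 0 w
    refine ⟨⟨⟨g, hK ⟨_, hg, ?_⟩⟩, 1, fun h => ?_⟩⟩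
    · rw [hw, endpoint_line, endpoint_zero]; simp
    · have h1 : g = 1 := congrArg Subtype.val h
      rw [h1] at hg0
      have : (0 : PlaneTree).len = w.len := congrArg ReducedPath.len hg0
      exact zero_ne_one this
  refine ⟨(levelGroup.prod translationGroup).subgroupOf twistedGroup,
    ⟨levelGroup, translationGroup, inferInstance, inferInstance, hnontriv _ le_rfl,
      hnontriv _ fun g ⟨d, hd, _⟩ => ⟨d, hd⟩,
      ⟨(Subgroup.subgroupOfEquivOfLe level_prod_le).trans (Subgroup.prodEquiv _ _)⟩⟩, ?_⟩
  rintro C ⟨x, hx⟩ hconv hinv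
  refine Set.eq_univ_of_forall fun y => ?_
  have hinv' : ∀ g₁ ∈ levelGroup, ∀ g₂ ∈ translationGroup,
      WithLp.toLp 1 (g₁ x.fst, g₂ x.snd) ∈ C := fun g₁ h₁ g₂ h₂ =>
    hinv ⟨⟨(g₁, g₂), level_prod_le ⟨h₁, h₂⟩⟩, Subgroup.mem_subgroupOf.2 ⟨h₁, h₂⟩⟩ x hx
  obtain ⟨γ, hγ, hγy⟩ := exists_translation x.snd y.snd
  obtain ⟨g₁, h₁, g₂, h₂, hb⟩ := exists_level_between x.fst y.fst
  -- `γ` hits the second coordinate of `y` exactly, so only betweenness in the first tree remains.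
  refine hconv _ (hinv' g₁ h₁ γ ⟨_, hγ⟩) _ (hinv' g₂ h₂ γ ⟨_, hγ⟩) y ?_
  rw [hγy, dist_prod, dist_prod, dist_prod]
  change dist (g₁ x.fst) y.fst + dist y.snd y.snd + (dist y.fst (g₂ x.fst) + dist y.snd y.snd) =
    dist (g₁ x.fst) (g₂ x.fst) + dist y.snd y.snd
  rw [dist_self, ← hb]; ring

end PlaneTree

open PlaneTree ReducedPath in
theorem corollaryC :
    ∃ (T : Type) (_ : MetricSpace T),
      Nonempty T ∧ CompleteSpace T ∧ IsRealTree T ∧ HasValence T Cardinal.continuum ∧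
      ∃ G : Subgroup ((T ≃ᵢ T) × (T ≃ᵢ T)),
        IsIsometricSMul G (WithLp 1 (T × T)) ∧
        (∀ (g : G) (p : WithLp 1 (T × T)), g • p = p → g = 1) ∧
        MulAction.IsPretransitive G (WithLp 1 (T × T)) ∧
        ¬ CoboundedlyReducible G (WithLp 1 (T × T)) ∧
        EssentiallyReducible G (WithLp 1 (T × T)) := by
  refine ⟨PlaneTree, inferInstance, ⟨0⟩, inferInstance, isTreeLike.isRealTree, hasValence,
    twistedGroup, ⟨fun g => Isometry.of_dist_eq fun p q => ?_⟩, fun g p hgp => ?_,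
    ⟨fun p q => ?_⟩, not_coboundedlyReducible, essentiallyReducible⟩
  · rw [dist_prod, dist_prod]
    exact congrArg₂ (· + ·) (g.1.1.dist_eq _ _) (g.1.2.dist_eq _ _)
  · exact Subtype.ext (twistedGroup_eq_one g.2 (x := p.fst) (y := p.snd)
      (congrArg (fun p => WithLp.fst p) hgp) (congrArg (fun p => WithLp.snd p) hgp))
  · obtain ⟨g₁, h₁, e₁⟩ := exists_translation p.fst q.fst
    obtain ⟨g₂, d, h₂, e₂⟩ :=
      exists_covers (twist (q.fst.endpoint - p.fst.endpoint).1.re) p.snd q.snd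
    refine ⟨⟨(g₁, g₂), _, d, h₁, h₂⟩, ?_⟩
    change WithLp.toLp 1 (g₁ p.fst, g₂ p.snd) = q
    rw [e₁, e₂]; rfl
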